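/- Let $\mathbb Z_L^d$ be the $d$-dimensional lattice with $L\ge 1$ sites in each direction ($N=L^d$ sites), with a spin of finite local dimension (e.g. a qubit) at each site. Let $H=\sum_{\alpha\in\mathbb Z_L^d}H_\alpha$ be a geometrically local Hamiltonian: each $H_\alpha$ is Hermitian, $\|H_\alpha\|\le\zeta$, and $H_\alpha$ acts non-trivially only on sites within distance $r_0$ of $\alpha$. Let $O$ be a Hermitian observable that acts non-trivially on at most $s$ sites. Let $$H'=H+\sum_{i=1}^M g_iV_i,\qquad M\le\kappa N,$$ where each $V_i$ is Hermitian with $\|V_i\|\le 1$ and acts non-trivially only on sites within distance $r_1$ of some site, and each site is acted on non-trivially by at most $K$ of the $V_i$. The real random variables $g_i$ are independent, and each is a $\chi$-deformed Gaussian: $g_i=\chi_i(\theta_i)$ with $\theta_i\sim\mathcal N(0,1)$, where $\chi_i:\mathbb R\to\mathbb R$ is strictly increasing and differentiable with $|\chi_i'|\le\delta$, $\chi_i(0)=0$, $\chi_i(\pm\infty)=\pm\Gamma_i$, $\mathbb E[\chi_i(\theta_i)]=0$, and $\Gamma_i\le\Gamma_0<\infty$. Let $0<\delta\le\delta_0<1$,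 $t\ge0$, and $t^{d/2+1}\delta\le B$. There is an absolute constant $c>0$, and for all $d,r_0,r_1,s,K,\zeta,\kappa,\Gamma_0,B$ and $\delta_0<1$ there is a constant $C>0$ depending only on these parameters (in particular not on the system size $N$), such that for every quantum state $\rho$ and every $a>0$, with probability at least $1-2e^{-ca^2}$, $$\big|\mathrm{tr}[\rho e^{iH't}Oe^{-iH't}]-\mathrm{tr}[\rho e^{iHt}Oe^{-iHt}]\big|\le C\,a\,t^{d/2+1}\delta\|O\|+C\,a\,t\,\delta\,\log^{d/2}(\delta^{-1})\|O\|.$$ -/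

import Mathlib

open MeasureTheory ProbabilityTheory Filter Topology
open scoped Matrix.Norms.L2Operator ComplexOrder

namespace AnalogSim

/-- The `d`-dimensional lattice `ℤ_L^d` with `L` sites in each direction. -/
abbrev Torus (d L : ℕ) : Type := Fin d → ZMod L

/-- Distance on the (periodic) lattice: the largest coordinate distance modulo `L`.
Every distance with open boundary conditions and every `ℓ^p` distance dominates it, so a term
which is local for one of those is local for this one. -/
def latticeDist {d L : ℕ} (x y : Torus d L) : ℕ :=
  Finset.univ.sup fun i => (x i - y i).valMinAbs.natAbs

/-- Computational basis labels of a system of `q`-level spins, one per lattice site. -/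
abbrev Config (d L q : ℕ) : Type := Torus d L → Fin q

/-- Operators on the Hilbert space `⨂_x ℂ^q`, as matrices in the computational basis.
`‖A‖` is the operator (spectral) norm. -/
abbrev Operator (d L q : ℕ) : Type := Matrix (Config d L q) (Config d L q) ℂ

/-- `A` acts trivially on the site `x`: it has the form `1_x ⊗ B`, with `B` an operator on the
other sites. -/
def ActsTriviallyAt {d L q : ℕ} (A : Operator d L q) (x : Torus d L) : Prop :=
  ∀ σ τ : Config d L q,
    (σ x ≠ τ x → A σ τ = 0) ∧
    (σ x = τ x → ∀ s : Fin q, A (Function.update σ x s) (Function.update τ x s) = A σ τ)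

/-- The set of sites on which `A` acts non-trivially. -/
def opSupport {d L q : ℕ} (A : Operator d L q) : Set (Torus d L) :=
  {x | ¬ ActsTriviallyAt A x}

/-- `ρ` is a quantum state (density matrix). -/
def IsState {d L q : ℕ} [NeZero L] (ρ : Operator d L q) : Prop :=
  ρ.PosSemidef ∧ ρ.trace = 1

/-- Heisenberg picture evolution `e^{iHt} O e^{-iHt}`. -/
noncomputable def heisenberg {d L q : ℕ} [NeZero L] (H O : Operator d L q) (t : ℝ) :
    Operator d L q :=
  NormedSpace.exp ((Complex.I * (t : ℂ)) • H) * O * NormedSpace.exp ((-(Complex.I * (t : ℂ))) • H)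

/-- `g` is a `χ`-deformed Gaussian random variable with parameters `δ` and `Γ ∈ (0, +∞]`. -/
structure IsDeformedGaussian {Ω : Type*} [MeasurableSpace Ω] (μ : Measure Ω)
    (χ : ℝ → ℝ) (δ : ℝ) (Γ : EReal) (g : Ω → ℝ) : Prop where
  strictMono : StrictMono χ
  differentiable : Differentiable ℝ χ
  abs_deriv_le : ∀ x, |deriv χ x| ≤ δ
  map_zero : χ 0 = 0
  tendsto_atTop : Tendsto (fun x => (χ x : EReal)) atTop (𝓝 Γ)
  tendsto_atBot : Tendsto (fun x => (χ x : EReal)) atBot (𝓝 (-Γ))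
  mean_zero : ∫ x, χ x ∂(gaussianReal 0 1) = 0
  exists_gaussian : ∃ θ : Ω → ℝ, HasLaw θ (gaussianReal 0 1) μ ∧ g = fun ω => χ (θ ω)

end AnalogSim

open AnalogSim

/-!
The expectation value is a function `F θ = tr (ρ e^{iH't} O e^{-iH't})` of independent standard
Gaussian variables `θ i`, and `F 0` is its value for the ideal Hamiltonian. Everything rests on two
bounds on the dependence of `F` on a single variable.

Let `w i` bound `‖⁅V i, O(u)⁆‖` for `0 ≤ u ≤ t`, where `O(u)` evolves under the Hamiltonian without
the term `V i`. By Duhamel's formula, `F` changes by at most `δ t (w i) |θ i|` when `θ i` is switched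
on (`norm_evolve_add_smul_sub_le`), and up to a term linear in `χ i (θ i)` only by
`2 (δ t)² (w i) |θ i|²` (`exists_norm_evolve_add_smul_sub_sub_le`). As `χ i (θ i)` is centred, the
mean of this change is of second order, at most `2 (δ t)² (w i)`.

These bounds tensorize without a martingale (`lintegral_exp_pi_gaussianReal_le`): for one variable,
`e^x ≤ x + cosh (2 x)` bounds the exponential moment of `F - F 0` by the sum of its mean and a
Gaussian factor, and the variables are integrated out one by one, each being set to zero once it has
been integrated out. The result is a subgaussian tail with variance proxy of order `∑ (δ t (w i))²`
around `F 0`, up to a bias of order `∑ (δ t)² (w i)`.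

The Lieb–Robinson bound controls the `w i` uniformly over the noise, because the noise is bounded by
`Γ₀` (`exists_bound_norm_lie_evolve`). It is derived for the commutators `⁅X j, O(u)⁆` of the terms
of the Hamiltonian themselves (`lieb_robinson`): in the frame rotating with the terms that commute
with `X j`, the derivative of such a commutator involves only the commutators of the neighbouring
terms, and Grönwall's inequality applies to the exponentially weighted vector of all of them. Hence
`w i` is of order `‖O‖` in the light cone of `O` and decays exponentially outside, so that `∑ i, w i`
is of order `(1 + t)^d ‖O‖`, independently of the size of the lattice.

With `τ = δ t (1 + t)^(d/2) ‖O‖`, the variance proxy is thus of order `τ²`. The bias is of order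
`δ t (1 + t)^(d/2) τ`, which is of order `τ` if `t^(d/2+1) δ ≤ B`. For `t ≥ 1`, the scale `τ` is at
most of the order of the first error term of the theorem; for `t ≤ 1` it is of order `δ t ‖O‖`, which
the second term covers since `log δ⁻¹ ≥ log δ₀⁻¹ > 0`.
-/

/-! ### Heisenberg evolution in a C⋆-algebra -/

section Evolution

theorem norm_lie_le {R : Type*} [NormedRing R] (X Y : R) : ‖⁅X, Y⁆‖ ≤ 2 * ‖X‖ * ‖Y‖ := by
  rw [Ring.lie_def]
  calc _ ≤ ‖X * Y‖ + ‖Y * X‖ := norm_sub_le _ _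
    _ ≤ ‖X‖ * ‖Y‖ + ‖Y‖ * ‖X‖ := add_le_add (norm_mul_le _ _) (norm_mul_le _ _)
    _ = _ := by ring

theorem IsSelfAdjoint.add_ofReal_smul {R : Type*} [NormedRing R] [NormedAlgebra ℂ R]
    [StarRing R] [StarModule ℂ R] {H V : R} (hH : IsSelfAdjoint H) (hV : IsSelfAdjoint V)
    (x : ℝ) : IsSelfAdjoint (H + (x : ℂ) • V) :=
  hH.add (IsSelfAdjoint.smul (by simp [isSelfAdjoint_iff]) hV)

variable {A : Type*} [NormedRing A] [NormedAlgebra ℂ A]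

/-- The Heisenberg evolution `e^{iHt} X e^{-iHt}` of an element `X` of a C⋆-algebra. For matrices
this is `AnalogSim.heisenberg` by definition. -/
noncomputable def evolve (H X : A) (t : ℝ) : A :=
  NormedSpace.exp ((Complex.I * (t : ℂ)) • H) * X * NormedSpace.exp ((-(Complex.I * (t : ℂ))) • H)

theorem evolve_zero (H X : A) : evolve H X 0 = X := by
  simp [evolve]

theorem evolve_smul (H X : A) (z : ℂ) (t : ℝ) : evolve H (z • X) t = z • evolve H X t := by
  simp [evolve]

theorem evolve_sub (H X Y : A) (t : ℝ) : evolve H (X - Y) t = evolve H X t - evolve H Y t := by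
  simp [evolve, mul_sub, sub_mul]

variable [CompleteSpace A]

theorem exp_smul_mul_exp_neg_smul (H : A) (z : ℂ) :
    NormedSpace.exp (z • H) * NormedSpace.exp ((-z) • H) = 1 := by
  let _ : NormedAlgebra ℚ A := NormedAlgebra.restrictScalars ℚ ℂ A
  rw [← NormedSpace.exp_add_of_commute (((Commute.refl H).smul_left z).smul_right (-z)),
    ← add_smul]
  simp

/-- The evolution is multiplicative, so it commutes with commutators. -/
theorem evolve_lie (H X Y : A) (t : ℝ) : evolve H ⁅X, Y⁆ t = ⁅evolve H X t, evolve H Y t⁆ := by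
  have h : ∀ X Y : A, evolve H (X * Y) t = evolve H X t * evolve H Y t := by
    intro X Y
    have := exp_smul_mul_exp_neg_smul H (-(Complex.I * (t : ℂ)))
    rw [neg_neg] at this
    unfold evolve
    calc _ = NormedSpace.exp ((Complex.I * (t : ℂ)) • H) * X * 1 * Y
          * NormedSpace.exp ((-(Complex.I * (t : ℂ))) • H) := by noncomm_ring
      _ = _ := by rw [← this]; noncomm_ring
  rw [Ring.lie_def, Ring.lie_def, evolve_sub, h, h]

theorem evolve_of_commute {H X : A} (h : Commute H X) (t : ℝ) : evolve H X t = X := by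
  let _ : NormedAlgebra ℚ A := NormedAlgebra.restrictScalars ℚ ℂ A
  have h1 : Commute (NormedSpace.exp ((Complex.I * (t : ℂ)) • H)) X :=
    (h.smul_left _).exp_left
  unfold evolve
  rw [h1.eq, mul_assoc, exp_smul_mul_exp_neg_smul, mul_one]

theorem hasDerivAt_exp_mul_I (H : A) (t : ℝ) :
    HasDerivAt (fun u : ℝ => NormedSpace.exp ((Complex.I * (u : ℂ)) • H))
      (NormedSpace.exp ((Complex.I * (t : ℂ)) • H) * (Complex.I • H)) t := by
  have h := (hasDerivAt_exp_smul_const (𝕂 := ℂ) (Complex.I • H) (t : ℂ)).scomp t Complex.ofRealCLM.hasDerivAt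
  simpa [Function.comp_def, smul_smul, mul_comm Complex.I] using h

theorem hasDerivAt_exp_neg_mul_I (H : A) (t : ℝ) :
    HasDerivAt (fun u : ℝ => NormedSpace.exp ((-(Complex.I * (u : ℂ))) • H))
      (-((Complex.I • H) * NormedSpace.exp ((-(Complex.I * (t : ℂ))) • H))) t := by
  have h := (hasDerivAt_exp_smul_const' (𝕂 := ℂ) (-(Complex.I • H)) (t : ℂ)).scomp t
    Complex.ofRealCLM.hasDerivAt
  simpa [Function.comp_def, smul_smul, mul_comm Complex.I] using h

/-- Product rule for the evolution of a time-dependent element. -/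
theorem HasDerivAt.evolve {H : A} {Y : ℝ → A} {Y' : A} {t : ℝ} (hY : HasDerivAt Y Y' t) :
    HasDerivAt (fun u => evolve H (Y u) u) (evolve H (Complex.I • ⁅H, Y t⁆ + Y') t) t := by
  have h := ((hasDerivAt_exp_mul_I H t).mul hY).mul (hasDerivAt_exp_neg_mul_I H t)
  refine h.congr_deriv ?_
  simp only [_root_.evolve, Ring.lie_def, Pi.mul_apply]
  simp only [smul_sub, mul_add, add_mul, mul_sub, sub_mul, smul_mul_assoc, mul_smul_comm, mul_assoc,
    mul_neg]
  abel

theorem hasDerivAt_evolve (H X : A) (t : ℝ) :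
    HasDerivAt (fun u => evolve H X u) (Complex.I • ⁅H, evolve H X t⁆) t := by
  have h := (hasDerivAt_const t X).evolve (H := H)
  refine h.congr_deriv ?_
  rw [add_zero, evolve_smul, evolve_lie, evolve_of_commute (Commute.refl H)]

/-- Subtracting from `H` a part `K` that commutes with `X`, and passing to the frame that rotates
with `K`, leaves only `H - K` in the derivative of the commutator `⁅X, e^{iHt} O e^{-iHt}⁆`. -/
theorem hasDerivAt_rotated_lie {X K : A} (H O : A) (hXK : Commute X K) (t : ℝ) :
    HasDerivAt (fun u => evolve (-K) ⁅X, evolve H O u⁆ u)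
      (evolve (-K) (Complex.I • ⁅X, ⁅H - K, evolve H O t⁆⁆) t) t := by
  have h1 : HasDerivAt (fun u => ⁅X, evolve H O u⁆) ⁅X, Complex.I • ⁅H, evolve H O t⁆⁆ t := by
    simp only [Ring.lie_def]
    exact ((hasDerivAt_evolve H O t).const_mul X).sub ((hasDerivAt_evolve H O t).mul_const X)
  refine (h1.evolve (H := -K)).congr_deriv ?_
  congr 1
  have h3 : ⁅K, ⁅X, evolve H O t⁆⁆ = ⁅X, ⁅K, evolve H O t⁆⁆ := by
    have h4 := hXK.eq
    simp only [Ring.lie_def, mul_sub, sub_mul, ← mul_assoc, h4]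
    simp only [mul_assoc, h4]
    abel
  have h5 : ⁅X, ⁅H - K, evolve H O t⁆⁆ = ⁅X, ⁅H, evolve H O t⁆⁆ - ⁅X, ⁅K, evolve H O t⁆⁆ := by
    simp only [Ring.lie_def]
    noncomm_ring
  rw [h5, ← h3]
  simp only [Ring.lie_def, mul_sub, sub_mul, mul_smul_comm, smul_mul_assoc, smul_sub, neg_mul,
    mul_neg, smul_neg]
  abel

/-- Duhamel's formula in differential form: the interpolation between the evolutions under `H` and
under `H + x • V`. -/
theorem hasDerivAt_duhamel (H V O : A) (x t s : ℝ) :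
    HasDerivAt (fun u => evolve (H + (x : ℂ) • V) (evolve H O (t - u)) u)
      ((x : ℂ) • evolve (H + (x : ℂ) • V) (Complex.I • ⁅V, evolve H O (t - s)⁆) s) s := by
  have h1 : HasDerivAt (fun u => evolve H O (t - u)) (-(Complex.I • ⁅H, evolve H O (t - s)⁆)) s := by
    have := (hasDerivAt_evolve H O (t - s)).scomp s ((hasDerivAt_id s).const_sub t)
    simpa [Function.comp_def] using this
  refine (h1.evolve (H := H + (x : ℂ) • V)).congr_deriv ?_
  rw [← evolve_smul]
  congr 1
  simp only [Ring.lie_def, add_mul, mul_add, smul_sub, smul_add, smul_mul_assoc, mul_smul_comm,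
    smul_comm (x : ℂ) Complex.I]
  abel

variable [StarRing A] [CStarRing A] [StarModule ℂ A]

theorem exp_smul_mem_unitary {H : A} (hH : IsSelfAdjoint H) (t : ℝ) :
    NormedSpace.exp ((Complex.I * (t : ℂ)) • H) ∈ unitary A := by
  let _ : NormedAlgebra ℚ A := NormedAlgebra.restrictScalars ℚ ℂ A
  apply NormedSpace.exp_mem_unitary_of_mem_skewAdjoint
  rw [skewAdjoint.mem_iff, star_smul, hH.star_eq, ← neg_smul]
  simp

theorem norm_evolve {H : A} (hH : IsSelfAdjoint H) (X : A) (t : ℝ) : ‖evolve H X t‖ = ‖X‖ := by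
  have h1 := exp_smul_mem_unitary hH t
  have h2 := exp_smul_mem_unitary hH (-t)
  have h3 : (Complex.I * ((-t : ℝ) : ℂ)) = -(Complex.I * (t : ℂ)) := by push_cast; ring
  rw [h3] at h2
  unfold evolve
  rw [CStarRing.norm_mul_mem_unitary _ h2, CStarRing.norm_mem_unitary_mul _ h1]

/-! ### The Lieb–Robinson bound -/

/-- Lieb–Robinson bound for `H = ∑ j, c j • X j`. The set `N j` contains all `k` for which `X k`
does not commute with `X j`; the weight `ω`, which bounds the commutators with `O` at time zero,
plays the role of `e^{-dist(X j, O)}`. -/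
theorem lieb_robinson {ι : Type*} [Fintype ι] [DecidableEq ι] (X : ι → A)
    (hX : ∀ j, IsSelfAdjoint (X j)) (c : ι → ℝ) (N : ι → Finset ι)
    (hN : ∀ j, ∀ k ∉ N j, Commute (X j) (X k)) (O : A) {a b E m Δ : ℝ}
    (ha : ∀ j, ‖X j‖ ≤ a) (hb : ∀ j, |c j| ≤ b) (hΔ : ∀ j, ((N j).card : ℝ) ≤ Δ)
    (ha0 : 0 ≤ a) (hb0 : 0 ≤ b) (hE0 : 0 ≤ E) (hm0 : 0 ≤ m)
    (ω : ι → ℝ) (hω : ∀ j, 0 < ω j) (hωN : ∀ j, ∀ k ∈ N j, ω k ≤ E * ω j)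
    (hO : ∀ j, ‖⁅X j, O⁆‖ ≤ m * ω j) {t : ℝ} (ht : 0 ≤ t) (j : ι) :
    ‖⁅X j, evolve (∑ k, (c k : ℂ) • X k) O t⁆‖
      ≤ m * Real.exp (2 * a * b * Δ * E * t) * ω j := by
  set H : A := ∑ k, (c k : ℂ) • X k with hH
  let K : ι → A := fun j => ∑ k ∈ (N j)ᶜ, (c k : ℂ) • X k
  have hsa : ∀ k, IsSelfAdjoint ((c k : ℂ) • X k) := fun k =>
    IsSelfAdjoint.smul (by simp [isSelfAdjoint_iff]) (hX k)
  have hK : ∀ j, IsSelfAdjoint (-K j) := fun j => (isSelfAdjoint_sum _ fun k _ => hsa k).neg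
  have hXK : ∀ j, Commute (X j) (K j) := fun j => Commute.sum_right _ _ _ fun k hk =>
    (hN j k (by simpa using hk)).smul_right _
  have hHK : ∀ j, H - K j = ∑ k ∈ N j, (c k : ℂ) • X k := by
    intro j
    rw [sub_eq_iff_eq_add, hH, ← Finset.sum_add_sum_compl (N j)]
  -- the vector of weighted commutators, each in its own rotating frame
  let G : ℝ → ι → A := fun u j => (ω j)⁻¹ • evolve (-K j) ⁅X j, evolve H O u⁆ u
  let G' : ℝ → ι → A := fun u j =>
    (ω j)⁻¹ • evolve (-K j) (Complex.I • ⁅X j, ⁅H - K j, evolve H O u⁆⁆) u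
  have hG : ∀ u, HasDerivAt G (G' u) u := fun u => hasDerivAt_pi.2 fun j =>
    (hasDerivAt_rotated_lie H O (hXK j) u).const_smul _
  have hGn : ∀ u j, ‖⁅X j, evolve H O u⁆‖ = ω j * ‖G u j‖ := by
    intro u j
    simp only [G, norm_smul, norm_evolve (hK j), norm_inv, Real.norm_eq_abs, abs_of_pos (hω j)]
    rw [mul_inv_cancel_left₀ (hω j).ne']
  have hbound : ∀ u, ‖G' u‖ ≤ (2 * a * b * Δ * E) * ‖G u‖ + 0 := by
    intro u
    have hΔ0 : 0 ≤ Δ := (Nat.cast_nonneg _).trans (hΔ j)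
    rw [add_zero, pi_norm_le_iff_of_nonneg (by positivity)]
    intro j
    simp only [G', norm_smul, norm_evolve (hK j), norm_inv, Real.norm_eq_abs, abs_of_pos (hω j),
      Complex.norm_I, one_mul]
    rw [inv_mul_le_iff₀ (hω j)]
    have h1 : ‖⁅H - K j, evolve H O u⁆‖ ≤ ∑ k ∈ N j, b * (E * ω j * ‖G u‖) := by
      have hsum : ⁅H - K j, evolve H O u⁆ = ∑ k ∈ N j, ⁅(c k : ℂ) • X k, evolve H O u⁆ := by
        simp only [hHK, Ring.lie_def, Finset.sum_mul, Finset.mul_sum, Finset.sum_sub_distrib]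
      rw [hsum]
      refine (norm_sum_le _ _).trans (Finset.sum_le_sum fun k hk => ?_)
      have : ⁅(c k : ℂ) • X k, evolve H O u⁆ = (c k : ℂ) • ⁅X k, evolve H O u⁆ := by
        simp only [Ring.lie_def, smul_mul_assoc, mul_smul_comm, smul_sub]
      rw [this, norm_smul, Complex.norm_real, Real.norm_eq_abs, hGn]
      have := norm_le_pi_norm (G u) k
      have := hωN j k hk
      have := (hω k).le
      have := (hω j).le
      gcongr
      exact hb k
    calc _ ≤ 2 * ‖X j‖ * ‖⁅H - K j, evolve H O u⁆‖ := norm_lie_le _ _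
      _ ≤ 2 * a * (Δ * (b * (E * ω j * ‖G u‖))) := by
        rw [Finset.sum_const, nsmul_eq_mul] at h1
        have := (hω j).le
        have h2 := h1.trans (mul_le_mul_of_nonneg_right (hΔ j) (by positivity))
        gcongr
        exact ha j
      _ = _ := by ring
  have hG0 : ‖G 0‖ ≤ m := by
    rw [pi_norm_le_iff_of_nonneg hm0]
    intro j
    have h1 := hGn 0 j
    rw [evolve_zero] at h1
    exact le_of_mul_le_mul_left (by rw [← h1, mul_comm]; exact hO j) (hω j)
  have h1 := norm_le_gronwallBound_of_norm_deriv_right_le (f := G) (f' := G') (a := 0) (b := t)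
    (fun u _ => (hG u).continuousAt.continuousWithinAt) (fun u _ => (hG u).hasDerivWithinAt)
    hG0 (fun u _ => hbound u) t ⟨ht, le_rfl⟩
  rw [gronwallBound_ε0, sub_zero] at h1
  rw [hGn, mul_comm]
  exact mul_le_mul_of_nonneg_right ((norm_le_pi_norm _ j).trans h1) (hω j).le

/-! ### First and second order perturbation theory -/

/-- Only the commutator of the perturbation with the observable evolved by the unperturbed `H`
enters, so a Lieb–Robinson bound is needed for `H` alone. -/
theorem norm_evolve_add_smul_sub_le {H V : A} (hH : IsSelfAdjoint H) (hV : IsSelfAdjoint V)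
    (O : A) (x : ℝ) {t w : ℝ} (ht : 0 ≤ t) (hw : ∀ s, 0 ≤ s → s ≤ t → ‖⁅V, evolve H O s⁆‖ ≤ w) :
    ‖evolve (H + (x : ℂ) • V) O t - evolve H O t‖ ≤ |x| * w * t := by
  have h := norm_image_sub_le_of_norm_deriv_le_segment' (a := 0) (b := t) (C := |x| * w)
    (fun s _ => (hasDerivAt_duhamel H V O x t s).hasDerivWithinAt) (fun s hs => ?_) t ⟨ht, le_rfl⟩
  · simpa [evolve_zero] using h
  · rw [norm_smul, norm_evolve (hH.add_ofReal_smul hV x), norm_smul, Complex.norm_real,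
      Complex.norm_I, one_mul, Real.norm_eq_abs]
    exact mul_le_mul_of_nonneg_left (hw _ (by linarith [hs.2]) (by linarith [hs.1])) (abs_nonneg x)

/-- The change of the evolution is linear in the strength `x` of the perturbation up to a quadratic
error, which inherits the smallness of the commutator of `V` with the evolved observable. -/
theorem exists_norm_evolve_add_smul_sub_sub_le {H V : A} (hH : IsSelfAdjoint H)
    (hV : IsSelfAdjoint V) (hV1 : ‖V‖ ≤ 1) (O : A) {t w : ℝ} (ht : 0 ≤ t)
    (hw : ∀ s, 0 ≤ s → s ≤ t → ‖⁅V, evolve H O s⁆‖ ≤ w) :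
    ∃ D : A, ∀ x : ℝ,
      ‖evolve (H + (x : ℂ) • V) O t - evolve H O t - (x : ℂ) • D‖ ≤ 2 * x ^ 2 * w * t ^ 2 := by
  have hw0 : 0 ≤ w := (norm_nonneg _).trans (hw 0 le_rfl ht)
  let Z : ℝ → A := fun s => Complex.I • ⁅V, evolve H O (t - s)⁆
  have hZn : ∀ s, ‖Z s‖ = ‖⁅V, evolve H O (t - s)⁆‖ := fun s => by simp [Z, norm_smul]
  have hZc : Continuous (fun s => evolve H (Z s) s) := by
    have h1 : ∀ s, HasDerivAt (fun s => evolve H O (t - s)) (-(Complex.I • ⁅H, evolve H O (t - s)⁆)) s := by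
      intro s
      have := (hasDerivAt_evolve H O (t - s)).scomp s ((hasDerivAt_id s).const_sub t)
      simpa [Function.comp_def] using this
    have h2 : ∀ s, ∃ D, HasDerivAt Z D s := by
      intro s
      simp only [Z, Ring.lie_def]
      exact ⟨_, (((h1 s).const_mul V).sub ((h1 s).mul_const V)).fun_const_smul _⟩
    refine continuous_iff_continuousAt.2 fun s => ?_
    obtain ⟨D, hD⟩ := h2 s
    exact hD.evolve.continuousAt
  refine ⟨∫ s in (0:ℝ)..t, evolve H (Z s) s, fun x => ?_⟩
  have hder : ∀ s, HasDerivAt (fun u => evolve (H + (x : ℂ) • V) (evolve H O (t - u)) u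
      - (x : ℂ) • ∫ r in (0:ℝ)..u, evolve H (Z r) r)
      ((x : ℂ) • (evolve (H + (x : ℂ) • V) (Z s) s - evolve H (Z s) s)) s := by
    intro s
    rw [smul_sub]
    exact (hasDerivAt_duhamel H V O x t s).sub
      ((hZc.integral_hasStrictDerivAt 0 s).hasDerivAt.const_smul (x : ℂ))
  have h := norm_image_sub_le_of_norm_deriv_le_segment' (a := 0) (b := t) (C := 2 * x ^ 2 * w * t)
    (fun s _ => (hder s).hasDerivWithinAt) (fun s hs => ?_) t ⟨ht, le_rfl⟩
  · simp only [evolve_zero, sub_self, sub_zero, intervalIntegral.integral_same, smul_zero] at h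
    rw [sub_right_comm]
    calc _ ≤ _ := h
      _ = _ := by ring
  · have h1 : ‖Z s‖ ≤ w := by
      rw [hZn]; exact hw _ (by linarith [hs.2]) (by linarith [hs.1])
    have h2 := norm_evolve_add_smul_sub_le (w := 2 * w) hH hV (Z s) x hs.1 (fun r _ _ => by
      calc _ ≤ 2 * ‖V‖ * ‖evolve H (Z s) r‖ := norm_lie_le _ _
        _ ≤ 2 * 1 * w := by rw [norm_evolve hH]; gcongr
        _ = _ := by ring)
    rw [norm_smul, Complex.norm_real, Real.norm_eq_abs]
    calc _ ≤ |x| * (|x| * (2 * w) * s) := by gcongr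
      _ ≤ |x| * (|x| * (2 * w) * t) := by gcongr; exact hs.2.le
      _ = 2 * (|x| ^ 2) * w * t := by ring
      _ = _ := by rw [sq_abs]

end Evolution

/-! ### Concentration for functions of independent Gaussian variables -/

theorem Real.exp_le_add_cosh_two_mul (x : ℝ) : Real.exp x ≤ x + Real.cosh (2 * x) := by
  have h1 : Real.exp x = Real.cosh x + Real.sinh x := (Real.cosh_add_sinh x).symm
  have h2 : Real.cosh x - Real.sinh x = Real.exp (-x) := Real.cosh_sub_sinh x
  have h3 : 1 - x ≤ Real.exp (-x) := by linarith [Real.add_one_le_exp (-x)]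
  have h4 := Real.one_le_cosh x
  have h5 := Real.cosh_sq x
  rw [h1, Real.cosh_two_mul]
  rcases le_total 0 x with hx | hx
  · nlinarith
  · have h6 : Real.sinh x ≤ x := by
      have := Real.self_le_sinh_iff.2 (neg_nonneg.2 hx)
      rw [Real.sinh_neg] at this
      linarith
    nlinarith

theorem integrable_cosh_mul_gaussianReal (r : ℝ) :
    Integrable (fun y => Real.cosh (r * y)) (gaussianReal 0 1) := by
  have h1 : Integrable (fun y => Real.exp (r * y)) (gaussianReal 0 1) :=
    integrable_exp_mul_gaussianReal r
  have h2 : Integrable (fun y => Real.exp (-r * y)) (gaussianReal 0 1) :=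
    integrable_exp_mul_gaussianReal (-r)
  refine ((h1.add h2).div_const 2).congr (ae_of_all _ fun y => ?_)
  simp [Real.cosh_eq]

theorem integral_cosh_mul_gaussianReal (r : ℝ) :
    ∫ y, Real.cosh (r * y) ∂(gaussianReal 0 1) = Real.exp (r ^ 2 / 2) := by
  have h : ∀ r : ℝ, ∫ y, Real.exp (r * y) ∂(gaussianReal 0 1) = Real.exp (r ^ 2 / 2) := by
    intro r
    have := congrFun (mgf_id_gaussianReal (μ := 0) (v := 1)) r
    simpa [mgf] using this
  have h1 : Integrable (fun y => Real.exp (r * y)) (gaussianReal 0 1) :=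
    integrable_exp_mul_gaussianReal r
  have h2 : Integrable (fun y => Real.exp (-r * y)) (gaussianReal 0 1) :=
    integrable_exp_mul_gaussianReal (-r)
  have h3 : ∀ y : ℝ, Real.cosh (r * y) = (Real.exp (r * y) + Real.exp (-r * y)) / 2 := by
    intro y
    rw [Real.cosh_eq, neg_mul]
  simp_rw [h3]
  rw [integral_div, integral_add h1 h2, h, h]
  simp

theorem integrable_abs_gaussianReal : Integrable (fun y : ℝ => |y|) (gaussianReal 0 1) :=
  ((memLp_id_gaussianReal 1).integrable (by simp)).abs

/-- The exponential moment of one Lipschitz function `h` of a Gaussian variable, centred at `h 0`: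
the deviation of the mean of `h` from `h 0` enters separately from the fluctuations. -/
theorem lintegral_exp_gaussianReal_le {h : ℝ → ℝ} (hm : Measurable h) {L B : ℝ}
    (hL : ∀ y, |h y - h 0| ≤ L * |y|) (hB : |∫ y, (h y - h 0) ∂(gaussianReal 0 1)| ≤ B) (r : ℝ) :
    ∫⁻ y, ENNReal.ofReal (Real.exp (r * h y)) ∂(gaussianReal 0 1)
      ≤ ENNReal.ofReal (Real.exp (r * h 0 + (|r| * B + 2 * r ^ 2 * L ^ 2))) := by
  have hB0 : 0 ≤ B := (abs_nonneg _).trans hB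
  have hL0 : 0 ≤ L := by simpa using (abs_nonneg _).trans (hL 1)
  have hZ : Integrable (fun y => h y - h 0) (gaussianReal 0 1) :=
    (integrable_abs_gaussianReal.const_mul L).mono' (by fun_prop) (ae_of_all _ fun y => hL y)
  have hc := integrable_cosh_mul_gaussianReal (2 * r * L)
  have hpt : ∀ y, Real.exp (r * (h y - h 0)) ≤ r * (h y - h 0) + Real.cosh (2 * r * L * y) := by
    intro y
    refine (Real.exp_le_add_cosh_two_mul _).trans (add_le_add le_rfl ?_)
    rw [Real.cosh_le_cosh]
    simp only [abs_mul, abs_of_nonneg hL0]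
    calc |2| * (|r| * |h y - h 0|) ≤ |2| * (|r| * (L * |y|)) := by gcongr; exact hL y
      _ = _ := by ring
  have hint : Integrable (fun y => r * (h y - h 0) + Real.cosh (2 * r * L * y)) (gaussianReal 0 1) :=
    (hZ.const_mul r).add hc
  have hexp : Integrable (fun y => Real.exp (r * (h y - h 0))) (gaussianReal 0 1) := by
    refine hint.mono' (by fun_prop) (ae_of_all _ fun y => ?_)
    rw [Real.norm_eq_abs, abs_of_pos (Real.exp_pos _)]
    exact hpt y
  have hmain : ∫ y, Real.exp (r * (h y - h 0)) ∂(gaussianReal 0 1)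
      ≤ Real.exp (|r| * B + 2 * r ^ 2 * L ^ 2) := by
    calc _ ≤ ∫ y, (r * (h y - h 0) + Real.cosh (2 * r * L * y)) ∂(gaussianReal 0 1) :=
          integral_mono hexp hint hpt
      _ = r * ∫ y, (h y - h 0) ∂(gaussianReal 0 1) + Real.exp ((2 * r * L) ^ 2 / 2) := by
          rw [integral_add (hZ.const_mul r) hc, integral_const_mul, integral_cosh_mul_gaussianReal]
      _ ≤ |r| * B + Real.exp (2 * r ^ 2 * L ^ 2) := by
          have h1 : (2 * r * L) ^ 2 / 2 = 2 * r ^ 2 * L ^ 2 := by ring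
          rw [h1]
          refine add_le_add ((le_abs_self _).trans ?_) le_rfl
          rw [abs_mul]
          gcongr
      _ ≤ Real.exp (|r| * B) * Real.exp (2 * r ^ 2 * L ^ 2) := by
          have h1 := Real.add_one_le_exp (|r| * B)
          have h2 : 1 ≤ Real.exp (2 * r ^ 2 * L ^ 2) := Real.one_le_exp (by positivity)
          have h3 : 0 ≤ |r| * B := by positivity
          nlinarith
      _ = _ := (Real.exp_add _ _).symm
  have hfac : ∀ y, ENNReal.ofReal (Real.exp (r * h y))
      = ENNReal.ofReal (Real.exp (r * h 0)) * ENNReal.ofReal (Real.exp (r * (h y - h 0))) := by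
    intro y
    rw [← ENNReal.ofReal_mul (Real.exp_pos _).le, ← Real.exp_add]
    ring_nf
  rw [lintegral_congr hfac, lintegral_const_mul' _ _ ENNReal.ofReal_ne_top, Real.exp_add,
    ENNReal.ofReal_mul (Real.exp_pos _).le,
    ← ofReal_integral_eq_lintegral_ofReal hexp (ae_of_all _ fun y => (Real.exp_pos _).le)]
  gcongr

/-- The one-variable bound tensorizes: the variables are integrated out one after the other, and
each one that has been integrated out is set to zero. -/
theorem lintegral_exp_pi_gaussianReal_le {M : ℕ} {F : (Fin M → ℝ) → ℝ} (hF : Measurable F)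
    {L B : Fin M → ℝ}
    (hL : ∀ i θ y, |F (Function.update θ i y) - F (Function.update θ i 0)| ≤ L i * |y|)
    (hB : ∀ i θ, |∫ y, (F (Function.update θ i y) - F (Function.update θ i 0))
      ∂(gaussianReal 0 1)| ≤ B i) (r : ℝ) :
    ∫⁻ θ, ENNReal.ofReal (Real.exp (r * F θ)) ∂(Measure.pi fun _ : Fin M => gaussianReal 0 1)
      ≤ ENNReal.ofReal (Real.exp (r * F 0 + ∑ i, (|r| * B i + 2 * r ^ 2 * L i ^ 2))) := by
  induction M with
  | zero =>
    have h0 : ∀ θ : Fin 0 → ℝ, F θ = F 0 := fun θ => congrArg F (Subsingleton.elim _ _)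
    simp [h0]
  | succ M ih =>
    have hcons : ∀ (x y : ℝ) (θ : Fin M → ℝ),
        Function.update (Fin.cons x θ : Fin (M + 1) → ℝ) 0 y = Fin.cons y θ :=
      fun x y θ => Fin.update_cons_zero (α := fun _ => ℝ) x θ y
    have hmp := (measurePreserving_piFinSuccAbove
      (fun _ : Fin (M + 1) => gaussianReal 0 1) 0).symm
    have hcm : Measurable fun p : ℝ × (Fin M → ℝ) => (Fin.cons p.1 p.2 : Fin (M + 1) → ℝ) := by
      refine measurable_pi_iff.2 fun i => ?_
      refine Fin.cases ?_ (fun i => ?_) i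
      · simpa using measurable_fst
      · simpa [Function.comp_def] using (measurable_pi_apply i).comp measurable_snd
    have hFc : Measurable fun p : ℝ × (Fin M → ℝ) => F (Fin.cons p.1 p.2) := hF.comp hcm
    have hsymm : ∀ p : ℝ × (Fin M → ℝ),
        (MeasurableEquiv.piFinSuccAbove (fun _ : Fin (M + 1) => ℝ) 0).symm p
          = Fin.cons p.1 p.2 := by
      intro p
      exact Fin.insertNth_zero (α := fun _ => ℝ) p.1 p.2
    rw [← hmp.lintegral_comp (by fun_prop)]
    simp_rw [hsymm]
    rw [lintegral_prod_symm' _ (by fun_prop)]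
    have hstep : ∀ θ : Fin M → ℝ,
        ∫⁻ y, ENNReal.ofReal (Real.exp (r * F (Fin.cons y θ))) ∂(gaussianReal 0 1)
          ≤ ENNReal.ofReal (Real.exp (r * F (Fin.cons 0 θ)))
            * ENNReal.ofReal (Real.exp (|r| * B 0 + 2 * r ^ 2 * L 0 ^ 2)) := by
      intro θ
      rw [← ENNReal.ofReal_mul (Real.exp_pos _).le, ← Real.exp_add]
      refine lintegral_exp_gaussianReal_le (h := fun y => F (Fin.cons y θ))
        (hFc.comp (measurable_id.prodMk measurable_const)) (fun y => ?_) ?_ r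
      · simpa [hcons] using hL 0 (Fin.cons 0 θ) y
      · simpa [hcons] using hB 0 (Fin.cons 0 θ)
    refine (lintegral_mono hstep).trans ?_
    rw [lintegral_mul_const' _ _ ENNReal.ofReal_ne_top]
    have hIH := ih (F := fun θ => F (Fin.cons 0 θ))
      (hFc.comp (measurable_const.prodMk measurable_id)) (L := fun i => L i.succ)
      (B := fun i => B i.succ)
      (fun i θ y => by simpa [Fin.cons_update] using hL i.succ (Fin.cons 0 θ) y)
      (fun i θ => by simpa [Fin.cons_update] using hB i.succ (Fin.cons 0 θ))
    refine (mul_le_mul_left hIH _).trans ?_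
    have h0 : (Fin.cons 0 0 : Fin (M + 1) → ℝ) = 0 := by
      ext i
      refine Fin.cases ?_ (fun i => ?_) i <;> simp
    rw [← ENNReal.ofReal_mul (Real.exp_pos _).le, ← Real.exp_add, h0, Fin.sum_univ_succ]
    apply le_of_eq
    congr 2
    ring

/-- Two-sided subgaussian tail around the value at zero, for deviations that are at least twice the
bias bound `β`. -/
theorem pi_gaussianReal_tail_le {M : ℕ} {F : (Fin M → ℝ) → ℝ} (hF : Measurable F)
    {L B : Fin M → ℝ}
    (hL : ∀ i θ y, |F (Function.update θ i y) - F (Function.update θ i 0)| ≤ L i * |y|)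
    (hB : ∀ i θ, |∫ y, (F (Function.update θ i y) - F (Function.update θ i 0))
      ∂(gaussianReal 0 1)| ≤ B i)
    {S β u : ℝ} (hS0 : 0 < S) (hS : ∑ i, L i ^ 2 ≤ S) (hβ : ∑ i, B i ≤ β) (hu0 : 0 ≤ u)
    (hu : 2 * β ≤ u) :
    (Measure.pi fun _ : Fin M => gaussianReal 0 1).real {θ | u < |F θ - F 0|}
      ≤ 2 * Real.exp (-(u ^ 2 / (32 * S))) := by
  set P : Measure (Fin M → ℝ) := Measure.pi fun _ : Fin M => gaussianReal 0 1 with hP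
  -- the exponential Chebyshev inequality, for either sign of the exponent
  have key : ∀ r : ℝ, |r| = u / (8 * S) →
      P {θ | |r| * u ≤ r * (F θ - F 0)} ≤ ENNReal.ofReal (Real.exp (-(u ^ 2 / (32 * S)))) := by
    intro r hr
    have h1 := lintegral_exp_pi_gaussianReal_le hF hL hB r
    have h2 := mul_meas_ge_le_lintegral (μ := P)
      (f := fun θ => ENNReal.ofReal (Real.exp (r * F θ))) (by fun_prop)
      (ENNReal.ofReal (Real.exp (r * F 0 + |r| * u)))
    have h3 : {θ | ENNReal.ofReal (Real.exp (r * F 0 + |r| * u))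
        ≤ ENNReal.ofReal (Real.exp (r * F θ))} = {θ | |r| * u ≤ r * (F θ - F 0)} := by
      ext θ
      simp only [Set.mem_ofPred_eq]
      rw [ENNReal.ofReal_le_ofReal_iff (Real.exp_pos _).le, Real.exp_le_exp]
      constructor <;> intro h <;> linarith
    rw [h3] at h2
    have h4 : P {θ | |r| * u ≤ r * (F θ - F 0)}
        = ENNReal.ofReal (Real.exp (-(r * F 0 + |r| * u)))
          * (ENNReal.ofReal (Real.exp (r * F 0 + |r| * u))
            * P {θ | |r| * u ≤ r * (F θ - F 0)}) := by
      rw [← mul_assoc, ← ENNReal.ofReal_mul (Real.exp_pos _).le, ← Real.exp_add]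
      simp
    rw [h4]
    refine (mul_le_mul_right (h2.trans h1) _).trans ?_
    rw [← ENNReal.ofReal_mul (Real.exp_pos _).le, ← Real.exp_add]
    apply ENNReal.ofReal_le_ofReal
    rw [Real.exp_le_exp, Finset.sum_add_distrib, ← Finset.mul_sum, ← Finset.mul_sum]
    have h5 : |r| * ∑ i, B i ≤ |r| * (u / 2) :=
      mul_le_mul_of_nonneg_left (by linarith) (abs_nonneg r)
    have h6 : 2 * r ^ 2 * ∑ i, L i ^ 2 ≤ 2 * r ^ 2 * S := by gcongr
    have h7 : -(|r| * u) + |r| * (u / 2) + 2 * |r| ^ 2 * S = -(u ^ 2 / (32 * S)) := by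
      rw [hr]
      field_simp
      ring
    rw [sq_abs] at h7
    linarith
  have hq : 0 ≤ u / (8 * S) := by positivity
  have hsub : {θ | u < |F θ - F 0|} ⊆
      {θ | |u / (8 * S)| * u ≤ u / (8 * S) * (F θ - F 0)}
        ∪ {θ | |-(u / (8 * S))| * u ≤ -(u / (8 * S)) * (F θ - F 0)} := by
    intro θ hθ
    simp only [Set.mem_union, Set.mem_ofPred_eq, abs_neg, abs_of_nonneg hq] at hθ ⊢
    rcases lt_abs.1 hθ with h | h
    · exact Or.inl (mul_le_mul_of_nonneg_left h.le hq)
    · right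
      rw [neg_mul, ← mul_neg]
      exact mul_le_mul_of_nonneg_left h.le hq
  refine ENNReal.toReal_le_of_le_ofReal (by positivity) ?_
  refine (measure_mono hsub).trans ((measure_union_le _ _).trans ?_)
  rw [two_mul, ENNReal.ofReal_add (Real.exp_pos _).le (Real.exp_pos _).le]
  exact add_le_add (key _ (abs_of_nonneg hq)) (key _ (by rw [abs_neg, abs_of_nonneg hq]))

namespace AnalogSim

/-! ### Operators with disjoint supports commute -/

/-- Matrix elements do not change when two configurations that agree on a set of sites where `A`
acts trivially are changed there in the same way. -/
theorem ActsTriviallyAt.apply_piecewise {d L q : ℕ} {A : Operator d L q} {T : Finset (Torus d L)}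
    (hA : ∀ x ∈ T, ActsTriviallyAt A x) {σ τ : Config d L q} (hστ : ∀ x ∈ T, σ x = τ x)
    (η : Config d L q) : A (T.piecewise η σ) (T.piecewise η τ) = A σ τ := by
  induction T using Finset.induction_on with
  | empty => simp
  | insert x T hx ih =>
    rw [Finset.piecewise_insert, Finset.piecewise_insert]
    have h1 : T.piecewise η σ x = T.piecewise η τ x := by
      simp [hx, hστ x (Finset.mem_insert_self x T)]
    rw [(hA x (Finset.mem_insert_self x T) _ _).2 h1]
    exact ih (fun y hy => hA y (Finset.mem_insert_of_mem hy))
      (fun y hy => hστ y (Finset.mem_insert_of_mem hy))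

theorem commute_of_disjoint_opSupport {d L q : ℕ} [NeZero L] {A B : Operator d L q}
    (h : Disjoint (opSupport A) (opSupport B)) : Commute A B := by
  classical
  let T : Finset (Torus d L) := Finset.univ.filter fun x => ActsTriviallyAt A x
  have hA : ∀ x ∈ T, ActsTriviallyAt A x := fun x hx => (Finset.mem_filter.1 hx).2
  have hB : ∀ x ∈ Tᶜ, ActsTriviallyAt B x := by
    intro x hx
    by_contra hBx
    have hAx : ¬ ActsTriviallyAt A x := by simpa [T] using hx
    exact Set.disjoint_left.1 h (show x ∈ opSupport A from hAx) hBx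
  ext σ τ
  -- in each product, a single intermediate configuration contributes
  have h1 : (A * B) σ τ = A σ (T.piecewise σ τ) * B (T.piecewise σ τ) τ := by
    rw [Matrix.mul_apply]
    refine Finset.sum_eq_single _ (fun ρ _ hρ => ?_) (by simp)
    obtain ⟨x, hx⟩ := Function.ne_iff.1 hρ
    by_cases hxT : x ∈ T
    · rw [(hA x hxT σ ρ).1 (by simpa [hxT] using hx.symm), zero_mul]
    · rw [(hB x (Finset.mem_compl.2 hxT) ρ τ).1 (by simpa [hxT] using hx), mul_zero]
  have h2 : (B * A) σ τ = B σ (T.piecewise τ σ) * A (T.piecewise τ σ) τ := by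
    rw [Matrix.mul_apply]
    refine Finset.sum_eq_single _ (fun ρ _ hρ => ?_) (by simp)
    obtain ⟨x, hx⟩ := Function.ne_iff.1 hρ
    by_cases hxT : x ∈ T
    · rw [(hA x hxT ρ τ).1 (by simpa [hxT] using hx), mul_zero]
    · rw [(hB x (Finset.mem_compl.2 hxT) σ ρ).1 (by simpa [hxT] using hx.symm), zero_mul]
  have h3 : A σ (T.piecewise σ τ) = A (T.piecewise τ σ) τ := by
    rw [← ActsTriviallyAt.apply_piecewise hA (fun x hx => by simp [hx]) τ]
    congr 1
    ext x
    by_cases hx : x ∈ T <;> simp [hx]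
  have h4 : B (T.piecewise σ τ) τ = B σ (T.piecewise τ σ) := by
    rw [← ActsTriviallyAt.apply_piecewise hB
      (fun x hx => by simp [Finset.mem_compl.1 hx]) σ]
    congr 1
    · ext x
      by_cases hx : x ∈ T <;> simp [hx]
    · ext x
      by_cases hx : x ∈ T <;> simp [hx]
  rw [h1, h2, h3, h4, mul_comm]

/-! ### Expectation values in a state -/

open scoped MatrixOrder in
theorem IsState.norm_trace_mul_le {d L q : ℕ} [NeZero L] {ρ : Operator d L q} (hρ : IsState ρ)
    (X : Operator d L q) : ‖(ρ * X).trace‖ ≤ ‖X‖ := by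
  obtain ⟨B, rfl⟩ := CStarAlgebra.nonneg_iff_eq_star_mul_self.mp hρ.1.nonneg
  let b : Config d L q → EuclideanSpace ℂ (Config d L q) := fun i => WithLp.toLp 2 (star (B i))
  rw [Matrix.star_eq_conjTranspose] at hρ ⊢
  have h1 : ∀ Y : Operator d L q, (B.conjTranspose * B * Y).trace
      = ∑ i, inner ℂ (b i) ((EuclideanSpace.equiv _ ℂ).symm (Y.mulVec (b i).ofLp)) := by
    intro Y
    rw [mul_assoc, Matrix.trace_mul_comm, Matrix.trace]
    refine Finset.sum_congr rfl fun i _ => ?_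
    rw [EuclideanSpace.inner_eq_star_dotProduct]
    rw [Matrix.diag_apply, mul_assoc, Matrix.mul_apply]
    simp only [b, dotProduct, Pi.star_apply, star_star, EuclideanSpace.equiv]
    refine Finset.sum_congr rfl fun k _ => ?_
    rw [mul_comm]
    rfl
  have h2 : (∑ i, ‖b i‖ ^ 2 : ℝ) = 1 := by
    have h := h1 1
    rw [mul_one, hρ.2] at h
    have h3 : ∀ i, inner ℂ (b i) ((EuclideanSpace.equiv _ ℂ).symm
        ((1 : Operator d L q).mulVec (b i).ofLp)) = ((‖b i‖ ^ 2 : ℝ) : ℂ) := by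
      intro i
      rw [Matrix.one_mulVec]
      simp
    simp_rw [h3] at h
    exact_mod_cast h.symm
  rw [h1]
  calc _ ≤ ∑ i, ‖X‖ * ‖b i‖ ^ 2 := by
        refine (norm_sum_le _ _).trans (Finset.sum_le_sum fun i _ => ?_)
        refine (norm_inner_le_norm _ _).trans ?_
        have := mul_le_mul_of_nonneg_left (Matrix.l2_opNorm_mulVec X (b i)) (norm_nonneg (b i))
        refine this.trans_eq (by ring)
    _ = ‖X‖ := by rw [← Finset.mul_sum, h2, mul_one]

theorem im_trace_mul_eq_zero {d L q : ℕ} [NeZero L] {ρ X : Operator d L q} (hρ : ρ.IsHermitian)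
    (hX : X.IsHermitian) : (ρ * X).trace.im = 0 := by
  have h : star (ρ * X).trace = (ρ * X).trace := by
    rw [← Matrix.trace_conjTranspose, Matrix.conjTranspose_mul, hρ.eq, hX.eq, Matrix.trace_mul_comm]
  exact Complex.conj_eq_iff_im.1 h

/-! ### Counting points of the lattice -/

theorem latticeDist_le_iff {d L : ℕ} {x y : Torus d L} {n : ℕ} :
    latticeDist x y ≤ n ↔ ∀ i, (x i - y i).valMinAbs.natAbs ≤ n := by
  simp [latticeDist, Finset.sup_le_iff]

theorem natAbs_valMinAbs_sub_le_latticeDist {d L : ℕ} (x y : Torus d L) (i : Fin d) :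
    (x i - y i).valMinAbs.natAbs ≤ latticeDist x y :=
  latticeDist_le_iff.1 le_rfl i

theorem latticeDist_comm {d L : ℕ} (x y : Torus d L) : latticeDist x y = latticeDist y x := by
  unfold latticeDist
  congr 1
  ext i
  rw [← ZMod.natAbs_valMinAbs_neg, neg_sub]

theorem latticeDist_triangle {d L : ℕ} (x y z : Torus d L) :
    latticeDist x z ≤ latticeDist x y + latticeDist y z := by
  rw [latticeDist_le_iff]
  intro i
  have h1 := natAbs_valMinAbs_sub_le_latticeDist x y i
  have h2 := natAbs_valMinAbs_sub_le_latticeDist y z i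
  have h3 := ZMod.natAbs_valMinAbs_add_le (x i - y i) (y i - z i)
  rw [sub_add_sub_cancel] at h3
  have h4 := Int.natAbs_add_le (x i - y i).valMinAbs (y i - z i).valMinAbs
  omega

theorem card_natAbs_valMinAbs_sub_le {L : ℕ} [NeZero L] (a : ZMod L) (r : ℕ) :
    (Finset.univ.filter fun z : ZMod L => (z - a).valMinAbs.natAbs ≤ r).card ≤ 2 * r + 1 := by
  have h := Finset.card_le_card_of_injOn
    (s := Finset.univ.filter fun z : ZMod L => (z - a).valMinAbs.natAbs ≤ r)
    (t := Finset.Icc (-(r : ℤ)) r) (fun z : ZMod L => (z - a).valMinAbs)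
    (fun z hz => by
      have := (Finset.mem_filter.1 hz).2
      simp only [Finset.coe_Icc, Set.mem_Icc]
      omega)
    (fun z _ z' _ h => by simpa using ZMod.injective_valMinAbs h)
  refine h.trans ?_
  rw [Int.card_Icc]
  omega

theorem card_latticeDist_le {d L : ℕ} [NeZero L] (α : Torus d L) (r : ℕ) :
    (Finset.univ.filter fun x => latticeDist x α ≤ r).card ≤ (2 * r + 1) ^ d := by
  classical
  have h : (Finset.univ.filter fun x => latticeDist x α ≤ r)
      ⊆ Fintype.piFinset fun i =>
        Finset.univ.filter fun z : ZMod L => (z - α i).valMinAbs.natAbs ≤ r := by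
    intro x hx
    simpa [latticeDist_le_iff] using hx
  refine (Finset.card_le_card h).trans ?_
  rw [Fintype.card_piFinset]
  refine (Finset.prod_le_prod' fun i _ => card_natAbs_valMinAbs_sub_le (α i) r).trans ?_
  simp

theorem sum_range_min_exp_le {r : ℝ} (hr : 0 < r) {a : ℝ} (ha : 0 ≤ a) (n : ℕ) :
    ∑ k ∈ Finset.range n, min 1 (Real.exp ((a - k) * r))
      ≤ (1 + (1 - Real.exp (-r))⁻¹) * (1 + a) := by
  have hq : Real.exp (-r) < 1 := by simpa using hr
  set m := ⌈a⌉₊ with hm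
  have hnn : ∀ k : ℕ, 0 ≤ min 1 (Real.exp ((a - k) * r)) := fun k =>
    le_min zero_le_one (Real.exp_pos _).le
  calc _ ≤ ∑ k ∈ Finset.range (m + n), min 1 (Real.exp ((a - k) * r)) :=
        Finset.sum_le_sum_of_subset_of_nonneg
          (Finset.range_subset_range.2 (Nat.le_add_left n m)) fun k _ _ => hnn k
    _ = (∑ k ∈ Finset.range m, min 1 (Real.exp ((a - k) * r)))
        + ∑ k ∈ Finset.range n, min 1 (Real.exp ((a - (m + k : ℕ)) * r)) :=
        Finset.sum_range_add _ _ _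
    _ ≤ (∑ k ∈ Finset.range m, (1 : ℝ)) + ∑ k ∈ Finset.range n, Real.exp (-r) ^ k := by
        refine add_le_add (Finset.sum_le_sum fun k _ => min_le_left _ _)
          (Finset.sum_le_sum fun k _ => (min_le_right _ _).trans ?_)
        rw [← Real.exp_nat_mul, Real.exp_le_exp]
        have := Nat.le_ceil a
        push_cast
        nlinarith
    _ ≤ (a + 1) + (1 - Real.exp (-r))⁻¹ := by
        refine add_le_add ?_ ?_
        · simpa using (Nat.ceil_lt_add_one ha).le
        · rw [← tsum_geometric_of_lt_one (Real.exp_pos _).le hq]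
          exact (summable_geometric_of_lt_one (Real.exp_pos _).le hq).sum_le_tsum _
            fun k _ => by positivity
    _ ≤ _ := by
        have : 0 ≤ (1 - Real.exp (-r))⁻¹ := inv_nonneg.2 (by linarith)
        nlinarith

theorem sum_natAbs_valMinAbs_sub_le {L : ℕ} [NeZero L] (a : ZMod L) {f : ℕ → ℝ}
    (hf : ∀ n, 0 ≤ f n) :
    ∑ z : ZMod L, f (z - a).valMinAbs.natAbs ≤ 2 * ∑ n ∈ Finset.range (L + 1), f n := by
  have hmaps : ∀ z ∈ (Finset.univ : Finset (ZMod L)),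
      (z - a).valMinAbs.natAbs ∈ Finset.range (L + 1) := by
    intro z _
    have := ZMod.natAbs_valMinAbs_le (z - a)
    rw [Finset.mem_range]
    omega
  rw [← Finset.sum_fiberwise_of_maps_to hmaps, Finset.mul_sum]
  refine Finset.sum_le_sum fun n _ => ?_
  have h1 : ∑ z ∈ Finset.univ.filter (fun z : ZMod L => (z - a).valMinAbs.natAbs = n),
      f (z - a).valMinAbs.natAbs
      = ∑ z ∈ Finset.univ.filter (fun z : ZMod L => (z - a).valMinAbs.natAbs = n), f n :=
    Finset.sum_congr rfl fun z hz => by rw [(Finset.mem_filter.1 hz).2]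
  rw [h1, Finset.sum_const, nsmul_eq_mul]
  refine mul_le_mul_of_nonneg_right ?_ (hf n)
  have h2 := Finset.card_le_card_of_injOn
    (s := Finset.univ.filter fun z : ZMod L => (z - a).valMinAbs.natAbs = n)
    (t := ({(n : ℤ), -(n : ℤ)} : Finset ℤ)) (fun z : ZMod L => (z - a).valMinAbs)
    (fun z hz => by
      have := (Finset.mem_filter.1 hz).2
      simp only [Finset.coe_insert, Finset.coe_singleton, Set.mem_insert_iff,
        Set.mem_singleton_iff]
      omega)
    (fun z _ z' _ h => by simpa using ZMod.injective_valMinAbs h)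
  exact_mod_cast h2.trans Finset.card_le_two

/-- A light cone of radius `a` with an exponential tail contains `O((1 + a) ^ d)` sites,
uniformly in the size of the lattice. -/
theorem exists_sum_min_exp_latticeDist_le (d : ℕ) : ∃ C : ℝ, 0 < C ∧
    ∀ (L : ℕ) [NeZero L] (z : Torus d L) (a : ℝ), 0 ≤ a →
      ∑ x : Torus d L, min 1 (Real.exp (a - latticeDist x z)) ≤ C * (1 + a) ^ d := by
  classical
  -- the decay is distributed over the coordinates, so that the sum factorizes; the exponent is
  -- divided by `d + 1`, not `d`, to include `d = 0`
  set r : ℝ := ((d : ℝ) + 1)⁻¹ with hr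
  have hr0 : 0 < r := by positivity
  have hrd : r * d ≤ 1 := by
    rw [hr, inv_mul_le_iff₀ (by positivity)]
    linarith
  set c : ℝ := 2 * (1 + (1 - Real.exp (-r))⁻¹) with hc
  have hc0 : 0 < c := by
    have h1 : Real.exp (-r) < 1 := by simpa using hr0
    have h2 : 0 < (1 - Real.exp (-r))⁻¹ := inv_pos.2 (by linarith)
    positivity
  refine ⟨c ^ d, by positivity, fun L _ z a ha => ?_⟩
  let f : ℕ → ℝ := fun n => min 1 (Real.exp ((a - n) * r))
  have hf : ∀ n, 0 ≤ f n := fun n => le_min zero_le_one (Real.exp_pos _).le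
  have hle : ∀ x : Torus d L, min 1 (Real.exp (a - latticeDist x z))
      ≤ ∏ i, f (x i - z i).valMinAbs.natAbs := by
    intro x
    have h1 : ∏ _i : Fin d, f (latticeDist x z) ≤ ∏ i, f (x i - z i).valMinAbs.natAbs := by
      refine Finset.prod_le_prod (fun i _ => hf _) fun i _ => ?_
      have : ((x i - z i).valMinAbs.natAbs : ℝ) ≤ latticeDist x z := by
        exact_mod_cast natAbs_valMinAbs_sub_le_latticeDist x z i
      exact min_le_min le_rfl (Real.exp_le_exp.2 (by gcongr))
    refine le_trans ?_ h1
    rw [Finset.prod_const, Finset.card_univ, Fintype.card_fin]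
    rcases le_total (latticeDist x z : ℝ) a with h | h
    · have : f (latticeDist x z) = 1 := by
        refine min_eq_left (Real.one_le_exp (mul_nonneg (by linarith) hr0.le))
      rw [this, one_pow]
      exact min_le_left _ _
    · have : f (latticeDist x z) = Real.exp ((a - latticeDist x z) * r) :=
        min_eq_right (by
          rw [← Real.exp_zero, Real.exp_le_exp]
          exact mul_nonpos_of_nonpos_of_nonneg (by linarith) hr0.le)
      rw [this, ← Real.exp_nat_mul]
      refine (min_le_right _ _).trans (Real.exp_le_exp.2 ?_)
      nlinarith
  calc _ ≤ ∑ x : Torus d L, ∏ i, f (x i - z i).valMinAbs.natAbs :=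
        Finset.sum_le_sum fun x _ => hle x
    _ = ∏ i, ∑ y : ZMod L, f (y - z i).valMinAbs.natAbs := by
        rw [Finset.prod_univ_sum, Fintype.piFinset_univ]
    _ ≤ ∏ _i : Fin d, (c * (1 + a)) := by
        refine Finset.prod_le_prod (fun i _ => Finset.sum_nonneg fun y _ => hf _) fun i _ => ?_
        refine (sum_natAbs_valMinAbs_sub_le (z i) hf).trans ?_
        rw [hc, mul_assoc]
        exact mul_le_mul_of_nonneg_left (sum_range_min_exp_le hr0 ha _) zero_le_two
    _ = _ := by simp [mul_pow]

/-! ### Locality of the evolution on the lattice -/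

/-- The Lieb–Robinson velocity of a sum of terms of radius `r` on `ℤ_L^d`, each of norm at most `a`
with a coefficient of modulus at most `b`, of which at most `n` act on any given site. -/
noncomputable def lrVelocity (d r n : ℕ) (a b : ℝ) : ℝ :=
  2 * a * b * (((2 * r + 1) ^ d * n : ℕ) : ℝ) * Real.exp (4 * r)

theorem lrVelocity_nonneg (d r n : ℕ) {a b : ℝ} (ha : 0 ≤ a) (hb : 0 ≤ b) :
    0 ≤ lrVelocity d r n a b := by
  unfold lrVelocity
  positivity

/-- Lieb–Robinson bound on the lattice. The point `p j` stands for the position of the term `X j`;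
it is arbitrary if `X j` is a multiple of the identity. -/
theorem norm_lie_evolve_le {d L q : ℕ} [NeZero L] {ι : Type*} [Fintype ι] [DecidableEq ι]
    {X : ι → Operator d L q} (hX : ∀ j, (X j).IsHermitian) {c : ι → ℝ} {a b : ℝ} {r n : ℕ}
    (ha0 : 0 ≤ a) (hb0 : 0 ≤ b) (ha : ∀ j, ‖X j‖ ≤ a) (hb : ∀ j, |c j| ≤ b)
    (hr : ∀ j, ∃ β, ∀ x ∈ opSupport (X j), latticeDist x β ≤ r)
    (hn : ∀ x, {j | x ∈ opSupport (X j)}.ncard ≤ n)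
    {p : ι → Torus d L} (hp : ∀ j, (opSupport (X j)).Nonempty → p j ∈ opSupport (X j))
    {O : Operator d L q} {S : Finset (Torus d L)} (hS : opSupport O ⊆ S) (hS0 : S.Nonempty)
    {t : ℝ} (ht : 0 ≤ t) (j : ι) :
    ‖⁅X j, evolve (∑ k, (c k : ℂ) • X k) O t⁆‖ ≤ 2 * a * ‖O‖ *
      (Real.exp (2 * r + lrVelocity d r n a b * t)
        * ∑ z ∈ S, Real.exp (-(latticeDist (p j) z : ℝ))) := by
  classical
  have hdiam : ∀ j, ∀ x ∈ opSupport (X j), ∀ y ∈ opSupport (X j), latticeDist x y ≤ 2 * r := by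
    intro j x hx y hy
    obtain ⟨β, hβ⟩ := hr j
    have h1 := latticeDist_triangle x β y
    have h2 := hβ x hx
    have h3 := hβ y hy
    rw [latticeDist_comm] at h3
    omega
  let N : ι → Finset ι := fun j =>
    Finset.univ.filter fun k => ¬ Disjoint (opSupport (X j)) (opSupport (X k))
  have hN : ∀ j k, k ∈ N j → ∃ y, y ∈ opSupport (X j) ∧ y ∈ opSupport (X k) := fun j k hk =>
    Set.not_disjoint_iff.1 (Finset.mem_filter.1 hk).2
  have hNcard : ∀ j, (N j).card ≤ (2 * r + 1) ^ d * n := by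
    intro j
    obtain ⟨β, hβ⟩ := hr j
    have hsub : N j ⊆ (Finset.univ.filter fun y => latticeDist y β ≤ r).biUnion
        fun y => Finset.univ.filter fun k => y ∈ opSupport (X k) := by
      intro k hk
      obtain ⟨y, hy1, hy2⟩ := hN j k hk
      exact Finset.mem_biUnion.2 ⟨y, by simpa using hβ y hy1, by simpa using hy2⟩
    refine (Finset.card_le_card hsub).trans ((Finset.card_biUnion_le_card_mul _ _ n ?_).trans
      (Nat.mul_le_mul_right n (card_latticeDist_le β r)))
    intro y _
    have h := hn y
    rwa [Set.ncard_eq_toFinset_card', Set.toFinset_ofPred] at h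
  let ω : ι → ℝ := fun j => ∑ z ∈ S, Real.exp (-(latticeDist (p j) z : ℝ))
  have hω : ∀ j, 0 < ω j := fun j => Finset.sum_pos (fun z _ => Real.exp_pos _) hS0
  have hωN : ∀ j, ∀ k ∈ N j, ω k ≤ Real.exp (4 * r) * ω j := by
    intro j k hk
    obtain ⟨y, hy1, hy2⟩ := hN j k hk
    simp only [ω]
    rw [Finset.mul_sum]
    refine Finset.sum_le_sum fun z _ => ?_
    rw [← Real.exp_add, Real.exp_le_exp]
    have h1 := hdiam j _ (hp j ⟨y, hy1⟩) y hy1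
    have h2 := hdiam k y hy2 _ (hp k ⟨y, hy2⟩)
    have h3 := latticeDist_triangle (p j) y z
    have h4 := latticeDist_triangle y (p k) z
    have h5 : latticeDist (p j) z ≤ 4 * r + latticeDist (p k) z := by omega
    have h6 : (latticeDist (p j) z : ℝ) ≤ 4 * r + latticeDist (p k) z := by exact_mod_cast h5
    linarith
  have hO : ∀ j, ‖⁅X j, O⁆‖ ≤ 2 * a * ‖O‖ * Real.exp (2 * r) * ω j := by
    intro j
    by_cases hd : Disjoint (opSupport (X j)) (opSupport O)
    · have h1 : ⁅X j, O⁆ = 0 := by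
        rw [Ring.lie_def, (commute_of_disjoint_opSupport hd).eq, sub_self]
      rw [h1, norm_zero]
      have := (hω j).le
      positivity
    · obtain ⟨y, hy1, hy2⟩ := Set.not_disjoint_iff.1 hd
      have h1 : Real.exp (-(2 * r : ℝ)) ≤ ω j := by
        have h2 : Real.exp (-(latticeDist (p j) y : ℝ)) ≤ ω j :=
          Finset.single_le_sum (f := fun z => Real.exp (-(latticeDist (p j) z : ℝ)))
            (fun z _ => (Real.exp_pos _).le) (hS hy2)
        refine le_trans (Real.exp_le_exp.2 (neg_le_neg ?_)) h2
        exact_mod_cast hdiam j _ (hp j ⟨y, hy1⟩) y hy1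
      calc _ ≤ 2 * ‖X j‖ * ‖O‖ := norm_lie_le _ _
        _ ≤ 2 * a * ‖O‖ := by gcongr; exact ha j
        _ = 2 * a * ‖O‖ * Real.exp (2 * r) * Real.exp (-(2 * r : ℝ)) := by
          rw [mul_assoc _ (Real.exp _), ← Real.exp_add, add_neg_cancel, Real.exp_zero, mul_one]
        _ ≤ _ := by gcongr
  have h := lieb_robinson X (fun j => hX j) c N
    (fun j k hk => commute_of_disjoint_opSupport (by simpa [N] using hk)) O ha hb
    (Δ := (((2 * r + 1) ^ d * n : ℕ) : ℝ)) (fun j => by exact_mod_cast hNcard j) ha0 hb0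
    (Real.exp_pos (4 * r)).le (by positivity) ω hω hωN hO ht j
  refine h.trans_eq ?_
  rw [Real.exp_add]
  simp only [ω, lrVelocity]
  ring

/-- Deterministic bounds `w i` for the commutators of the error terms with the evolved observable,
valid for all admissible strengths of the error terms, whose sum is bounded by the volume of the
light cone. -/
theorem exists_bound_norm_lie_evolve (d r₀ r₁ s K : ℕ) (ζ Γ₀ : ℝ) :
    ∃ C : ℝ, 0 < C ∧ ∀ (L q : ℕ) [NeZero L] (h : Torus d L → Operator d L q),
      (∀ α, (h α).IsHermitian) → (∀ α, ‖h α‖ ≤ ζ) →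
      (∀ α, ∀ x ∈ opSupport (h α), latticeDist x α ≤ r₀) →
    ∀ O : Operator d L q, (opSupport O).ncard ≤ s →
    ∀ (M : ℕ) (V : Fin M → Operator d L q),
      (∀ i, (V i).IsHermitian) → (∀ i, ‖V i‖ ≤ 1) →
      (∀ i, ∃ β : Torus d L, ∀ x ∈ opSupport (V i), latticeDist x β ≤ r₁) →
      (∀ x : Torus d L, {i | x ∈ opSupport (V i)}.ncard ≤ K) →
    ∀ t : ℝ, 0 ≤ t → ∃ w : Fin M → ℝ,
      (∀ i, 0 ≤ w i) ∧ (∀ i, w i ≤ C * ‖O‖) ∧ ∑ i, w i ≤ C * (1 + t) ^ d * ‖O‖ ∧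
      ∀ y : Fin M → ℝ, (∀ i, |y i| ≤ Γ₀) → ∀ i, ∀ u, 0 ≤ u → u ≤ t →
        ‖⁅V i, evolve (∑ α, h α + ∑ i, (y i : ℂ) • V i) O u⁆‖ ≤ w i := by
  classical
  obtain ⟨C₁, hC₁, hsum⟩ := exists_sum_min_exp_latticeDist_le d
  set r := max r₀ r₁ with hr
  set n := (2 * r + 1) ^ d + K with hn
  set a : ℝ := |ζ| + 1 with ha
  set b : ℝ := |Γ₀| + 1 with hb
  have ha0 : 0 ≤ a := by positivity
  have ha1 : 1 ≤ a := by simp [ha]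
  have hb0 : 0 ≤ b := by positivity
  have hv0 := lrVelocity_nonneg d r n ha0 hb0
  set v := lrVelocity d r n a b with hv
  set C := K * (2 * a * ((s + 1) * (C₁ * (1 + 2 * r + v) ^ d))) + 2 * a * (s + 1) with hC
  refine ⟨C, by positivity, ?_⟩
  intro L q _ h hh hζ hr₀ O hO M V hV hV1 hr₁ hK t ht
  let X : Torus d L ⊕ Fin M → Operator d L q := Sum.elim h V
  have hp : ∀ j, ∃ x, (opSupport (X j)).Nonempty → x ∈ opSupport (X j) := by
    intro j
    by_cases hne : (opSupport (X j)).Nonempty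
    · exact ⟨hne.some, fun _ => hne.some_mem⟩
    · exact ⟨0, fun h => absurd h hne⟩
  choose p hp using hp
  -- inserting the origin makes the support of the observable nonempty
  set S : Finset (Torus d L) := insert 0 (opSupport O).toFinset with hS
  have hScard : (S.card : ℝ) ≤ s + 1 := by
    have h1 : S.card ≤ s + 1 := (Finset.card_insert_le _ _).trans
      (Nat.succ_le_succ (by rwa [← Set.ncard_eq_toFinset_card']))
    exact_mod_cast h1
  set A : ℝ := 2 * r + v * t with hA
  have hA0 : 0 ≤ A := by positivity
  let G : Torus d L → ℝ := fun x =>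
    2 * a * ‖O‖ * ∑ z ∈ S, min 1 (Real.exp (A - latticeDist x z))
  have hmin : ∀ x z : Torus d L, 0 ≤ min 1 (Real.exp (A - latticeDist x z)) := fun x z =>
    le_min zero_le_one (Real.exp_pos _).le
  have hG0 : ∀ x, 0 ≤ G x := fun x =>
    mul_nonneg (by positivity) (Finset.sum_nonneg fun z _ => hmin x z)
  have hGle : ∀ x, G x ≤ 2 * a * (s + 1) * ‖O‖ := by
    intro x
    have h1 : ∑ z ∈ S, min 1 (Real.exp (A - latticeDist x z)) ≤ s + 1 := by
      refine (Finset.sum_le_sum fun z _ => min_le_left _ _).trans ?_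
      simpa using hScard
    calc G x ≤ 2 * a * ‖O‖ * (s + 1) := by simp only [G]; gcongr
      _ = _ := by ring
  have hGsum : ∑ x, G x ≤ 2 * a * ((s + 1) * (C₁ * (1 + 2 * r + v) ^ d)) * ((1 + t) ^ d * ‖O‖) := by
    simp only [G]
    rw [← Finset.mul_sum, Finset.sum_comm]
    have h1 : ∑ z ∈ S, ∑ x, min 1 (Real.exp (A - latticeDist x z))
        ≤ (s + 1) * (C₁ * (1 + A) ^ d) := by
      refine (Finset.sum_le_sum fun z _ => hsum L z A hA0).trans ?_
      rw [Finset.sum_const, nsmul_eq_mul]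
      gcongr
    have h2 : 1 + A ≤ (1 + 2 * r + v) * (1 + t) := by
      have : (0 : ℝ) ≤ r := Nat.cast_nonneg r
      rw [hA]
      nlinarith
    calc _ ≤ 2 * a * ‖O‖ * ((s + 1) * (C₁ * (1 + A) ^ d)) := by gcongr
      _ ≤ 2 * a * ‖O‖ * ((s + 1) * (C₁ * ((1 + 2 * r + v) * (1 + t)) ^ d)) := by gcongr
      _ = _ := by rw [mul_pow]; ring
  let w : Fin M → ℝ := fun i => if (opSupport (V i)).Nonempty then G (p (Sum.inr i)) else 0
  refine ⟨w, fun i => ?_, fun i => ?_, ?_, ?_⟩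
  · simp only [w]
    split_ifs
    exacts [hG0 _, le_rfl]
  · have h1 : 2 * a * (s + 1) * ‖O‖ ≤ C * ‖O‖ := by
      refine mul_le_mul_of_nonneg_right ?_ (norm_nonneg O)
      rw [hC]
      exact le_add_of_nonneg_left (by positivity)
    refine le_trans ?_ h1
    simp only [w]
    split_ifs
    exacts [hGle _, by positivity]
  · -- every site is the position of at most `K` error terms
    have h1 : ∀ i, w i ≤ ∑ x, if x ∈ opSupport (V i) then G x else 0 := by
      intro i
      have hnn : ∀ x, 0 ≤ if x ∈ opSupport (V i) then G x else 0 := fun x => by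
        split_ifs
        exacts [hG0 x, le_rfl]
      simp only [w]
      split_ifs with hne
      · have hmem : p (Sum.inr i) ∈ opSupport (V i) := hp (Sum.inr i) hne
        have h2 := Finset.single_le_sum (f := fun x => if x ∈ opSupport (V i) then G x else 0)
          (fun x _ => hnn x) (Finset.mem_univ (p (Sum.inr i)))
        simpa only [if_pos hmem] using h2
      · exact Finset.sum_nonneg fun x _ => hnn x
    calc ∑ i, w i ≤ ∑ i, ∑ x, (if x ∈ opSupport (V i) then G x else 0) :=
          Finset.sum_le_sum fun i _ => h1 i
      _ = ∑ x, ∑ i, (if x ∈ opSupport (V i) then G x else 0) := Finset.sum_comm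
      _ ≤ ∑ x, K * G x := by
          refine Finset.sum_le_sum fun x _ => ?_
          rw [← Finset.sum_filter, Finset.sum_const, nsmul_eq_mul]
          have h3 := hK x
          rw [Set.ncard_eq_toFinset_card', Set.toFinset_ofPred] at h3
          exact mul_le_mul_of_nonneg_right (by exact_mod_cast h3) (hG0 x)
      _ ≤ K * (2 * a * ((s + 1) * (C₁ * (1 + 2 * r + v) ^ d)) * ((1 + t) ^ d * ‖O‖)) := by
          rw [← Finset.mul_sum]
          gcongr
      _ = K * (2 * a * ((s + 1) * (C₁ * (1 + 2 * r + v) ^ d))) * ((1 + t) ^ d * ‖O‖) := by ring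
      _ ≤ C * ((1 + t) ^ d * ‖O‖) := by
          refine mul_le_mul_of_nonneg_right ?_ (by positivity)
          rw [hC]
          exact le_add_of_nonneg_right (by positivity)
      _ = _ := by ring
  · intro y hy i u hu0 hut
    let c : Torus d L ⊕ Fin M → ℝ := Sum.elim (fun _ => 1) y
    have hH : ∑ α, h α + ∑ i, (y i : ℂ) • V i = ∑ k, (c k : ℂ) • X k := by
      simp [Fintype.sum_sum_type, c, X]
    have hX : ∀ j, (X j).IsHermitian := by
      rintro (α | i)
      exacts [hh α, hV i]
    have hHsa : IsSelfAdjoint (∑ α, h α + ∑ i, (y i : ℂ) • V i) := by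
      rw [hH]
      exact isSelfAdjoint_sum _ fun k _ =>
        IsSelfAdjoint.smul (by simp [isSelfAdjoint_iff]) (hX k)
    simp only [w]
    split_ifs with hne
    · have hXa : ∀ j, ‖X j‖ ≤ a := by
        rintro (α | i)
        · exact (hζ α).trans ((le_abs_self ζ).trans (by simp [ha]))
        · exact (hV1 i).trans ha1
      have hcb : ∀ j, |c j| ≤ b := by
        rintro (α | i)
        · simp [c, hb]
        · exact (hy i).trans ((le_abs_self Γ₀).trans (by simp [hb]))
      have hXr : ∀ j, ∃ β, ∀ x ∈ opSupport (X j), latticeDist x β ≤ r := by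
        rintro (α | i)
        · exact ⟨α, fun x hx => (hr₀ α x hx).trans (le_max_left _ _)⟩
        · obtain ⟨β, hβ⟩ := hr₁ i
          exact ⟨β, fun x hx => (hβ x hx).trans (le_max_right _ _)⟩
      have hXn : ∀ x, {j | x ∈ opSupport (X j)}.ncard ≤ n := by
        intro x
        have h1 : {j | x ∈ opSupport (X j)} ⊆
            Sum.inl '' {α | latticeDist α x ≤ r} ∪ Sum.inr '' {i | x ∈ opSupport (V i)} := by
          rintro (α | i) hj
          · refine Or.inl ⟨α, ?_, rfl⟩
            have h2 := (hr₀ α x hj).trans (le_max_left r₀ r₁)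
            rwa [latticeDist_comm] at h2
          · exact Or.inr ⟨i, hj, rfl⟩
        refine (Set.ncard_le_ncard h1).trans ((Set.ncard_union_le _ _).trans ?_)
        rw [hn]
        refine add_le_add ((Set.ncard_image_le).trans ?_) ((Set.ncard_image_le).trans (hK x))
        have h2 := card_latticeDist_le x r
        rwa [Set.ncard_eq_toFinset_card', Set.toFinset_ofPred]
      have hLR := norm_lie_evolve_le hX ha0 hb0 hXa hcb hXr hXn hp (O := O) (S := S)
        (by intro z hz; simp [hS, hz]) ⟨0, by simp [hS]⟩ hu0 (Sum.inr i)
      rw [← hH] at hLR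
      set x := p (Sum.inr i) with hx
      have htriv : ‖⁅V i, evolve (∑ α, h α + ∑ i, (y i : ℂ) • V i) O u⁆‖ ≤ 2 * a * ‖O‖ * 1 := by
        refine (norm_lie_le _ _).trans ?_
        rw [norm_evolve hHsa, mul_one]
        have := (hV1 i).trans ha1
        gcongr
      have hLR' : ‖⁅V i, evolve (∑ α, h α + ∑ i, (y i : ℂ) • V i) O u⁆‖
          ≤ 2 * a * ‖O‖ * ∑ z ∈ S, Real.exp (A - latticeDist x z) := by
        refine hLR.trans ?_
        rw [Finset.mul_sum]
        refine mul_le_mul_of_nonneg_left (Finset.sum_le_sum fun z _ => ?_) (by positivity)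
        rw [← Real.exp_add, Real.exp_le_exp, hA, sub_eq_add_neg]
        gcongr
      simp only [G]
      by_cases hall : ∀ z ∈ S, Real.exp (A - latticeDist x z) ≤ 1
      · refine hLR'.trans_eq ?_
        congr 1
        exact Finset.sum_congr rfl fun z hz => (min_eq_right (hall z hz)).symm
      · push Not at hall
        obtain ⟨z, hz, hz1⟩ := hall
        refine htriv.trans (mul_le_mul_of_nonneg_left ?_ (by positivity))
        have h1 := Finset.single_le_sum
          (f := fun z => min 1 (Real.exp (A - latticeDist x z))) (fun z _ => hmin x z) hz
        simpa only [min_eq_left hz1.le] using h1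
    · have h1 : Commute (V i) (evolve (∑ α, h α + ∑ i, (y i : ℂ) • V i) O u) :=
        commute_of_disjoint_opSupport (by
          rw [Set.not_nonempty_iff_eq_empty.1 hne]
          exact Set.empty_disjoint _)
      rw [Ring.lie_def, h1.eq, sub_self, norm_zero]

/-! ### Deformed Gaussian variables -/

namespace IsDeformedGaussian

variable {Ω : Type*} [MeasurableSpace Ω] {μ : Measure Ω} {χ : ℝ → ℝ} {δ : ℝ} {Γ : EReal}
  {g : Ω → ℝ}

theorem abs_le_mul (h : IsDeformedGaussian μ χ δ Γ g) (x : ℝ) : |χ x| ≤ δ * |x| := by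
  have h1 := convex_univ.norm_image_sub_le_of_norm_deriv_le (f := χ) (C := δ) (x := 0) (y := x)
    (fun y _ => h.differentiable y) (fun y _ => h.abs_deriv_le y) (Set.mem_univ _) (Set.mem_univ _)
  simpa [h.map_zero] using h1

theorem abs_le (h : IsDeformedGaussian μ χ δ Γ g) {Γ₀ : ℝ} (hΓ : Γ ≤ (Γ₀ : EReal)) (x : ℝ) :
    |χ x| ≤ Γ₀ := by
  have hmono : Monotone fun x => (χ x : EReal) := fun x y hxy =>
    EReal.coe_le_coe_iff.2 (h.strictMono.monotone hxy)
  have h1 : (χ x : EReal) ≤ Γ := hmono.ge_of_tendsto h.tendsto_atTop x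
  have h2 : -Γ ≤ (χ x : EReal) := hmono.le_of_tendsto h.tendsto_atBot x
  rw [_root_.abs_le]
  constructor
  · have h3 : ((-Γ₀ : ℝ) : EReal) ≤ χ x := by
      rw [EReal.coe_neg]
      exact (EReal.neg_le_neg_iff.2 hΓ).trans h2
    exact_mod_cast h3
  · exact_mod_cast h1.trans hΓ

theorem map_eq (h : IsDeformedGaussian μ χ δ Γ g) :
    AEMeasurable g μ ∧ μ.map g = (gaussianReal 0 1).map χ := by
  obtain ⟨θ, hθ, rfl⟩ := h.exists_gaussian
  have hχ : Measurable χ := h.differentiable.continuous.measurable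
  refine ⟨hχ.comp_aemeasurable hθ.aemeasurable, ?_⟩
  rw [← hθ.map_eq, AEMeasurable.map_map_of_aemeasurable hχ.aemeasurable hθ.aemeasurable]
  rfl

end IsDeformedGaussian

/-- An event that depends on independent deformed Gaussian variables may be realised on the
Gaussian product space. -/
theorem measureReal_deformedGaussian_eq {Ω : Type*} [MeasurableSpace Ω] {μ : Measure Ω}
    [IsProbabilityMeasure μ] {M : ℕ} {δ : ℝ} {Γ : Fin M → EReal} {χ : Fin M → ℝ → ℝ}
    {g : Fin M → Ω → ℝ} (hg : ∀ i, IsDeformedGaussian μ (χ i) δ (Γ i) (g i))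
    (hind : iIndepFun g μ) {T : Set (Fin M → ℝ)} (hT : MeasurableSet T) :
    μ.real {ω | (fun i => g i ω) ∈ T}
      = (Measure.pi fun _ : Fin M => gaussianReal 0 1).real {θ | (fun i => χ i (θ i)) ∈ T} := by
  have hχ : ∀ i, Measurable (χ i) := fun i => (hg i).differentiable.continuous.measurable
  have h1 := (iIndepFun_iff_map_fun_eq_pi_map fun i => (hg i).map_eq.1).1 hind
  have hχm : Measurable fun (θ : Fin M → ℝ) i => χ i (θ i) :=
    measurable_pi_iff.2 fun i => (hχ i).comp (measurable_pi_apply i)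
  have hprob : ∀ i, IsProbabilityMeasure ((gaussianReal 0 1).map (χ i)) := fun i =>
    Measure.isProbabilityMeasure_map (hχ i).aemeasurable
  have h2 : μ.map (fun ω i => g i ω)
      = (Measure.pi fun _ : Fin M => gaussianReal 0 1).map fun θ i => χ i (θ i) := by
    rw [h1, Measure.pi_map_pi fun i => (hχ i).aemeasurable]
    congr 1
    ext1 i
    exact (hg i).map_eq.2
  have h3 := DFunLike.congr_fun h2 T
  rw [Measure.map_apply_of_aemeasurable (aemeasurable_pi_lambda _ fun i => (hg i).map_eq.1) hT,
    Measure.map_apply hχm hT] at h3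
  exact congrArg ENNReal.toReal h3

/-! ### Dependence of the expectation value on a single error term -/

theorem abs_re_trace_mul_le {d L q : ℕ} [NeZero L] {ρ : Operator d L q} (hρ : IsState ρ)
    (X : Operator d L q) : |(ρ * X).trace.re| ≤ ‖X‖ :=
  (Complex.abs_re_le_norm _).trans (hρ.norm_trace_mul_le X)

theorem abs_re_trace_evolve_sub_le {d L q : ℕ} [NeZero L] {ρ H V O : Operator d L q}
    (hρ : IsState ρ) (hH : H.IsHermitian) (hV : V.IsHermitian) {t w : ℝ} (ht : 0 ≤ t)
    (hw : ∀ u, 0 ≤ u → u ≤ t → ‖⁅V, evolve H O u⁆‖ ≤ w) (x : ℝ) :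
    |(ρ * evolve (H + (x : ℂ) • V) O t).trace.re - (ρ * evolve H O t).trace.re|
      ≤ |x| * w * t := by
  rw [← Complex.sub_re, ← Matrix.trace_sub, ← mul_sub]
  exact (abs_re_trace_mul_le hρ _).trans (norm_evolve_add_smul_sub_le hH hV O x ht hw)

/-- Because `χ` has mean zero under the Gaussian measure, the first order of perturbation theory
does not contribute to the bias. -/
theorem abs_integral_re_trace_evolve_sub_le {d L q : ℕ} [NeZero L] {ρ H V O : Operator d L q}
    (hρ : IsState ρ) (hH : H.IsHermitian) (hV : V.IsHermitian) (hV1 : ‖V‖ ≤ 1) {t w : ℝ}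
    (ht : 0 ≤ t) (hw : ∀ u, 0 ≤ u → u ≤ t → ‖⁅V, evolve H O u⁆‖ ≤ w) {χ : ℝ → ℝ} {δ : ℝ}
    (hχc : Continuous χ) (hχ : ∀ z, |χ z| ≤ δ * |z|)
    (hχ0 : ∫ z, χ z ∂(gaussianReal 0 1) = 0) :
    |∫ z, ((ρ * evolve (H + (χ z : ℂ) • V) O t).trace.re - (ρ * evolve H O t).trace.re)
      ∂(gaussianReal 0 1)| ≤ 2 * δ ^ 2 * t ^ 2 * w := by
  have hw0 : 0 ≤ w := (norm_nonneg _).trans (hw 0 le_rfl ht)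
  obtain ⟨D, hD⟩ := exists_norm_evolve_add_smul_sub_sub_le hH hV hV1 O ht hw
  set f : ℝ → ℝ := fun z =>
    (ρ * evolve (H + (χ z : ℂ) • V) O t).trace.re - (ρ * evolve H O t).trace.re with hf
  have hsq : Integrable (fun z : ℝ => z ^ 2) (gaussianReal 0 1) :=
    (memLp_id_gaussianReal 2).integrable_sq
  have hsq1 : ∫ z, z ^ 2 ∂(gaussianReal 0 1) = 1 := by
    have h1 := variance_fun_id_gaussianReal (μ := 0) (v := 1)
    rw [variance_eq_integral (by fun_prop)] at h1
    simpa using h1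
  have hχi : Integrable χ (gaussianReal 0 1) :=
    (integrable_abs_gaussianReal.const_mul δ).mono' hχc.aestronglyMeasurable
      (ae_of_all _ fun z => hχ z)
  have hrem : ∀ z, |f z - χ z * (ρ * D).trace.re| ≤ 2 * δ ^ 2 * t ^ 2 * w * z ^ 2 := by
    intro z
    have h1 : f z - χ z * (ρ * D).trace.re = (ρ * (evolve (H + (χ z : ℂ) • V) O t
        - evolve H O t - (χ z : ℂ) • D)).trace.re := by
      simp [hf, mul_sub, Matrix.trace_sub]
    rw [h1]
    refine (abs_re_trace_mul_le hρ _).trans ((hD (χ z)).trans ?_)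
    have h2 : χ z ^ 2 ≤ (δ * |z|) ^ 2 := by
      rw [← sq_abs]
      exact pow_le_pow_left₀ (abs_nonneg _) (hχ z) 2
    rw [mul_pow, sq_abs] at h2
    calc 2 * χ z ^ 2 * w * t ^ 2 ≤ 2 * (δ ^ 2 * z ^ 2) * w * t ^ 2 := by gcongr
      _ = _ := by ring
  have hfc : Continuous fun z => evolve (H + (χ z : ℂ) • V) O t := by
    let _ : NormedAlgebra ℚ (Operator d L q) := NormedAlgebra.restrictScalars ℚ ℂ _
    have he : Continuous (NormedSpace.exp : Operator d L q → Operator d L q) :=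
      NormedSpace.exp_continuous
    unfold evolve
    fun_prop
  have hfm : Continuous f := by
    have : Continuous fun z => (ρ * evolve (H + (χ z : ℂ) • V) O t).trace := by fun_prop
    exact (Complex.continuous_re.comp this).sub continuous_const
  have hremi : Integrable (fun z => f z - χ z * (ρ * D).trace.re) (gaussianReal 0 1) :=
    (hsq.const_mul (2 * δ ^ 2 * t ^ 2 * w)).mono'
      (hfm.sub (hχc.mul continuous_const)).aestronglyMeasurable (ae_of_all _ fun z => hrem z)
  have hint : ∫ z, f z ∂(gaussianReal 0 1)
      = ∫ z, (f z - χ z * (ρ * D).trace.re) ∂(gaussianReal 0 1) := by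
    have h1 : ∀ z, f z = (f z - χ z * (ρ * D).trace.re) + χ z * (ρ * D).trace.re := fun z => by
      ring
    rw [integral_congr_ae (ae_of_all _ h1), integral_add hremi (hχi.mul_const _),
      integral_mul_const, hχ0, zero_mul, add_zero]
  rw [hint]
  refine (abs_integral_le_integral_abs).trans ?_
  refine (integral_mono hremi.abs (hsq.const_mul _) hrem).trans_eq ?_
  rw [integral_const_mul, hsq1, mul_one]

/-! ### Comparison of the light cone with the powers of time and `log δ⁻¹` -/

theorem one_add_rpow_le {t e : ℝ} (ht : 0 ≤ t) (he : 0 ≤ e) :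
    (1 + t) ^ e ≤ 2 ^ e * (1 + t ^ e) := by
  have h2 : (0 : ℝ) ≤ 2 ^ e := by positivity
  have h3 : (0 : ℝ) ≤ t ^ e := by positivity
  rcases le_total t 1 with h | h
  · calc (1 + t) ^ e ≤ 2 ^ e := Real.rpow_le_rpow (by positivity) (by linarith) he
      _ ≤ _ := by nlinarith
  · calc (1 + t) ^ e ≤ (2 * t) ^ e := Real.rpow_le_rpow (by positivity) (by linarith) he
      _ = 2 ^ e * t ^ e := Real.mul_rpow zero_le_two ht
      _ ≤ _ := by nlinarith

/-- The bias, which is quadratic in `δ t (1 + t) ^ e`, is of the order of the fluctuations in the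
regime `t ^ (e + 1) * δ ≤ B`. -/
theorem mul_one_add_rpow_le {t e δ B : ℝ} (ht : 0 ≤ t) (he : 0 ≤ e) (hδ0 : 0 ≤ δ) (hδ1 : δ ≤ 1)
    (hB : t ^ (e + 1) * δ ≤ B) : δ * t * (1 + t) ^ e ≤ 2 ^ e * (1 + 2 * |B|) := by
  have h1 : t * t ^ e = t ^ (e + 1) := by
    rw [Real.rpow_add_one' ht (by linarith), mul_comm]
  have hB' : t ^ (e + 1) * δ ≤ |B| := hB.trans (le_abs_self B)
  have h2 : δ * t ≤ 1 + |B| := by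
    rcases le_total t 1 with h | h
    · nlinarith [abs_nonneg B]
    · have h3 : t ≤ t ^ (e + 1) := by
        simpa using Real.rpow_le_rpow_of_exponent_le h (by linarith : (1 : ℝ) ≤ e + 1)
      nlinarith
  calc δ * t * (1 + t) ^ e ≤ δ * t * (2 ^ e * (1 + t ^ e)) := by
        gcongr
        exact one_add_rpow_le ht he
    _ = 2 ^ e * (δ * t + (t * t ^ e) * δ) := by ring
    _ ≤ 2 ^ e * ((1 + |B|) + |B|) := by rw [h1]; gcongr
    _ = _ := by ring

/-- For times below one the power of `log δ⁻¹ ≥ log δ₀⁻¹ > 0` dominates the constant volume of the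
light cone. -/
theorem mul_one_add_rpow_le_log {t e δ δ₀ : ℝ} (ht : 0 ≤ t) (he : 0 ≤ e) (hδ : 0 < δ)
    (hδ₀ : δ ≤ δ₀) (hδ₁ : δ₀ < 1) :
    t * (1 + t) ^ e
      ≤ 2 ^ e * (1 + (Real.log δ₀⁻¹ ^ e)⁻¹) * (t ^ (e + 1) + t * Real.log δ⁻¹ ^ e) := by
  have hδ₀0 : 0 < δ₀ := hδ.trans_le hδ₀
  have hl0 : 0 < Real.log δ₀⁻¹ := Real.log_pos ((one_lt_inv₀ hδ₀0).2 hδ₁)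
  have hl : Real.log δ₀⁻¹ ≤ Real.log δ⁻¹ := Real.log_le_log (by positivity) (by gcongr)
  have hle : Real.log δ₀⁻¹ ^ e ≤ Real.log δ⁻¹ ^ e := Real.rpow_le_rpow hl0.le hl he
  have hp : 0 < Real.log δ₀⁻¹ ^ e := Real.rpow_pos_of_pos hl0 e
  have h1 : 1 ≤ (Real.log δ₀⁻¹ ^ e)⁻¹ * Real.log δ⁻¹ ^ e := by
    rw [← inv_mul_cancel₀ hp.ne']
    gcongr
  have hlp : 0 ≤ Real.log δ⁻¹ ^ e := hp.le.trans hle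
  have h2 : 0 ≤ t ^ e := by positivity
  have h3 : t * t ^ e = t ^ (e + 1) := by
    rw [Real.rpow_add_one' ht (by linarith), mul_comm]
  have hi : 0 < (Real.log δ₀⁻¹ ^ e)⁻¹ := inv_pos.2 hp
  have h4 : 1 + t ^ e ≤ (1 + (Real.log δ₀⁻¹ ^ e)⁻¹) * (t ^ e + Real.log δ⁻¹ ^ e) := by
    nlinarith [mul_nonneg hi.le h2]
  rw [← h3, ← mul_add]
  calc t * (1 + t) ^ e ≤ t * (2 ^ e * (1 + t ^ e)) := by gcongr; exact one_add_rpow_le ht he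
    _ ≤ t * (2 ^ e * ((1 + (Real.log δ₀⁻¹ ^ e)⁻¹) * (t ^ e + Real.log δ⁻¹ ^ e))) := by gcongr
    _ = _ := by ring

/-! ### Concentration of the expectation value of the observable -/

theorem continuous_trace_mul_evolve {d L q M : ℕ} [NeZero L] (ρ H O : Operator d L q)
    (V : Fin M → Operator d L q) (t : ℝ) :
    Continuous fun y : Fin M → ℝ => (ρ * evolve (H + ∑ i, (y i : ℂ) • V i) O t).trace := by
  let _ : NormedAlgebra ℚ (Operator d L q) := NormedAlgebra.restrictScalars ℚ ℂ _
  have he : Continuous (NormedSpace.exp : Operator d L q → Operator d L q) :=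
    NormedSpace.exp_continuous
  unfold evolve
  fun_prop

theorem isHermitian_evolve {d L q : ℕ} [NeZero L] {H O : Operator d L q} (hH : H.IsHermitian)
    (hO : O.IsHermitian) (t : ℝ) : (evolve H O t).IsHermitian := by
  have h1 : ∀ z : ℂ, (NormedSpace.exp (z • H)).conjTranspose = NormedSpace.exp (star z • H) := by
    intro z
    rw [← Matrix.exp_conjTranspose, Matrix.conjTranspose_smul, hH.eq]
  unfold evolve
  rw [Matrix.IsHermitian, Matrix.conjTranspose_mul, Matrix.conjTranspose_mul, h1, h1, hO.eq,
    ← mul_assoc]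
  simp

/-- Tail bound on the Gaussian product space for the deviation of the expectation value, with the
bounds `w i` on the commutators of the error terms as only information on the dynamics. -/
theorem gaussian_tail_trace_evolve_le {d L q M : ℕ} [NeZero L] {ρ H O : Operator d L q}
    {V : Fin M → Operator d L q} (hρ : IsState ρ) (hH : H.IsHermitian)
    (hV : ∀ i, (V i).IsHermitian) (hV1 : ∀ i, ‖V i‖ ≤ 1) {Γ₀ δ t : ℝ} {χ : Fin M → ℝ → ℝ}
    (hχc : ∀ i, Continuous (χ i)) (hχz : ∀ i, χ i 0 = 0) (hχ : ∀ i z, |χ i z| ≤ δ * |z|)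
    (hχΓ : ∀ i z, |χ i z| ≤ Γ₀) (hχ0 : ∀ i, ∫ z, χ i z ∂(gaussianReal 0 1) = 0)
    (ht : 0 ≤ t) {w : Fin M → ℝ}
    (hw : ∀ y : Fin M → ℝ, (∀ i, |y i| ≤ Γ₀) → ∀ i, ∀ u, 0 ≤ u → u ≤ t →
      ‖⁅V i, evolve (H + ∑ i, (y i : ℂ) • V i) O u⁆‖ ≤ w i)
    {S β u : ℝ} (hS0 : 0 < S) (hS : ∑ i, (δ * t * w i) ^ 2 ≤ S)
    (hβ : ∑ i, 2 * δ ^ 2 * t ^ 2 * w i ≤ β) (hu0 : 0 ≤ u) (hu : 2 * β ≤ u) :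
    (Measure.pi fun _ : Fin M => gaussianReal 0 1).real
      {θ | u < |(ρ * evolve (H + ∑ i, (χ i (θ i) : ℂ) • V i) O t).trace.re
        - (ρ * evolve H O t).trace.re|} ≤ 2 * Real.exp (-(u ^ 2 / (32 * S))) := by
  classical
  let F : (Fin M → ℝ) → ℝ := fun θ =>
    (ρ * evolve (H + ∑ i, (χ i (θ i) : ℂ) • V i) O t).trace.re
  have hχm : Continuous fun (θ : Fin M → ℝ) i => χ i (θ i) :=
    continuous_pi fun i => (hχc i).comp (continuous_apply i)
  have hF : Measurable F :=
    (Complex.continuous_re.comp ((continuous_trace_mul_evolve ρ H O V t).comp hχm)).measurable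
  have hF0 : F 0 = (ρ * evolve H O t).trace.re := by simp [F, hχz]
  -- the Hamiltonian without the term `i`, which is then switched on as a perturbation
  let H₀ : Fin M → (Fin M → ℝ) → Operator d L q := fun i θ =>
    H + ∑ j, (χ j (Function.update θ i 0 j) : ℂ) • V j
  have hH₀ : ∀ i θ, (H₀ i θ).IsHermitian := fun i θ =>
    IsSelfAdjoint.add hH (isSelfAdjoint_sum _ fun j _ =>
      IsSelfAdjoint.smul (by simp [isSelfAdjoint_iff]) (hV j))
  have hsplit : ∀ i θ z, H + ∑ j, (χ j (Function.update θ i z j) : ℂ) • V j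
      = H₀ i θ + (χ i z : ℂ) • V i := by
    intro i θ z
    simp only [H₀]
    rw [add_assoc]
    congr 1
    rw [← Finset.add_sum_erase _ _ (Finset.mem_univ i),
      ← Finset.add_sum_erase (a := i) Finset.univ
        (fun j => (χ j (Function.update θ i 0 j) : ℂ) • V j) (Finset.mem_univ i)]
    simp only [Function.update_self, hχz, Complex.ofReal_zero, zero_smul, zero_add]
    rw [add_comm]
    congr 1
    refine Finset.sum_congr rfl fun j hj => ?_
    rw [Function.update_of_ne (Finset.ne_of_mem_erase hj),
      Function.update_of_ne (Finset.ne_of_mem_erase hj)]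
  have hFz : ∀ i θ z, F (Function.update θ i z)
      = (ρ * evolve (H₀ i θ + (χ i z : ℂ) • V i) O t).trace.re := by
    intro i θ z
    simp only [F]
    rw [hsplit]
  have hFz0 : ∀ i θ, F (Function.update θ i 0) = (ρ * evolve (H₀ i θ) O t).trace.re :=
    fun i θ => rfl
  have hwi : ∀ i θ, ∀ u, 0 ≤ u → u ≤ t → ‖⁅V i, evolve (H₀ i θ) O u⁆‖ ≤ w i := fun i θ =>
    hw (fun j => χ j (Function.update θ i 0 j)) (fun j => hχΓ j _) i
  have hw0 : ∀ i, 0 ≤ w i := fun i => (norm_nonneg _).trans (hwi i 0 0 le_rfl ht)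
  have h := pi_gaussianReal_tail_le hF (L := fun i => δ * t * w i)
    (B := fun i => 2 * δ ^ 2 * t ^ 2 * w i) (fun i θ z => ?_) (fun i θ => ?_) hS0 hS hβ hu0 hu
  · rw [hF0] at h
    exact h
  · rw [hFz, hFz0]
    refine (abs_re_trace_evolve_sub_le hρ (hH₀ i θ) (hV i) ht (hwi i θ) (χ i z)).trans ?_
    have := hw0 i
    calc |χ i z| * w i * t ≤ (δ * |z|) * w i * t := by gcongr; exact hχ i z
      _ = _ := by ring
  · simp_rw [hFz0, hFz]
    exact abs_integral_re_trace_evolve_sub_le hρ (hH₀ i θ) (hV i) (hV1 i) ht (hwi i θ) (hχc i)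
      (hχ i) (hχ0 i)

/-- The tail bound with the commutator bounds of a light cone inserted: at the scale
`τ = δ t (1 + t)^(d/2) ‖O‖` both the bias and the fluctuations of the expectation value are of
order `τ`. -/
theorem gaussian_tail_trace_evolve_le_exp {d L q M : ℕ} [NeZero L] {ρ H O : Operator d L q}
    {V : Fin M → Operator d L q} (hρ : IsState ρ) (hH : H.IsHermitian)
    (hV : ∀ i, (V i).IsHermitian) (hV1 : ∀ i, ‖V i‖ ≤ 1) {Γ₀ δ t : ℝ} {χ : Fin M → ℝ → ℝ}
    (hχc : ∀ i, Continuous (χ i)) (hχz : ∀ i, χ i 0 = 0) (hχ : ∀ i z, |χ i z| ≤ δ * |z|)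
    (hχΓ : ∀ i z, |χ i z| ≤ Γ₀) (hχ0 : ∀ i, ∫ z, χ i z ∂(gaussianReal 0 1) = 0)
    (ht : 0 ≤ t) {w : Fin M → ℝ}
    (hw : ∀ y : Fin M → ℝ, (∀ i, |y i| ≤ Γ₀) → ∀ i, ∀ u, 0 ≤ u → u ≤ t →
      ‖⁅V i, evolve (H + ∑ i, (y i : ℂ) • V i) O u⁆‖ ≤ w i)
    {C₀ C₃ e a : ℝ} (hw0 : ∀ i, 0 ≤ w i) (hwC : ∀ i, w i ≤ C₀ * ‖O‖)
    (hwsum : ∑ i, w i ≤ C₀ * (1 + t) ^ d * ‖O‖) (hC₀ : 0 < C₀) (hC₃0 : 0 < C₃)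
    (he : e = (d : ℝ) / 2) (hsmall : δ * t * (1 + t) ^ e ≤ C₃)
    (hτ0 : 0 < δ * t * (1 + t) ^ e * ‖O‖) (ha : 1 / 2 ≤ a) :
    (Measure.pi fun _ : Fin M => gaussianReal 0 1).real
      {θ | (6 * C₀ + 8 * C₀ * C₃) * a * (δ * t * (1 + t) ^ e * ‖O‖)
        < |(ρ * evolve (H + ∑ i, (χ i (θ i) : ℂ) • V i) O t).trace.re
          - (ρ * evolve H O t).trace.re|} ≤ 2 * Real.exp (-a ^ 2) := by
  -- `6 * C₀` makes the tail at least as small as `exp (-a ^ 2)`, and `8 * C₀ * C₃` absorbs the bias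
  set C' : ℝ := 6 * C₀ + 8 * C₀ * C₃ with hC'
  have hC'0 : 0 < C' := by positivity
  have ha0 : 0 < a := by linarith
  set τ : ℝ := δ * t * (1 + t) ^ e * ‖O‖ with hτ
  have hsq : ((1 + t) ^ e) ^ 2 = (1 + t) ^ d := by
    rw [← Real.rpow_natCast ((1 + t) ^ e), ← Real.rpow_mul (by linarith), he,
      ← Real.rpow_natCast (1 + t) d]
    congr 1
    push_cast
    ring
  have hS : ∑ i, (δ * t * w i) ^ 2 ≤ C₀ ^ 2 * τ ^ 2 := by
    calc ∑ i, (δ * t * w i) ^ 2 ≤ ∑ i, (δ * t) ^ 2 * (C₀ * ‖O‖) * w i := by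
          refine Finset.sum_le_sum fun i _ => ?_
          rw [mul_pow, mul_assoc, sq (w i)]
          have := hw0 i
          have := hwC i
          gcongr
      _ = (δ * t) ^ 2 * (C₀ * ‖O‖) * ∑ i, w i := by rw [Finset.mul_sum]
      _ ≤ (δ * t) ^ 2 * (C₀ * ‖O‖) * (C₀ * (1 + t) ^ d * ‖O‖) := by gcongr
      _ = _ := by rw [hτ, ← hsq]; ring
  have hβ : ∑ i, 2 * δ ^ 2 * t ^ 2 * w i ≤ 2 * C₀ * C₃ * τ := by
    calc ∑ i, 2 * δ ^ 2 * t ^ 2 * w i = 2 * δ ^ 2 * t ^ 2 * ∑ i, w i := by rw [Finset.mul_sum]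
      _ ≤ 2 * δ ^ 2 * t ^ 2 * (C₀ * (1 + t) ^ d * ‖O‖) := by gcongr
      _ = 2 * C₀ * (δ * t * (1 + t) ^ e) * τ := by rw [hτ, ← hsq]; ring
      _ ≤ _ := by gcongr
  have htail := gaussian_tail_trace_evolve_le hρ hH hV hV1 hχc hχz hχ hχΓ hχ0 ht hw
    (u := C' * a * τ) (by positivity) hS hβ (by positivity) (by
      have h1 : 4 * C₀ * C₃ ≤ C' * a := by
        rw [hC']
        nlinarith [mul_pos hC₀ hC₃0, mul_pos hC₀ ha0]
      nlinarith)
  have hexp : Real.exp (-((C' * a * τ) ^ 2 / (32 * (C₀ ^ 2 * τ ^ 2)))) ≤ Real.exp (-a ^ 2) := by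
    rw [Real.exp_le_exp, neg_le_neg_iff, le_div_iff₀ (by positivity)]
    have h1 : 6 * C₀ ≤ C' := by
      rw [hC']
      exact le_add_of_nonneg_right (by positivity)
    calc a ^ 2 * (32 * (C₀ ^ 2 * τ ^ 2)) ≤ a ^ 2 * ((6 * C₀) ^ 2 * τ ^ 2) := by
          refine mul_le_mul_of_nonneg_left ?_ (sq_nonneg a)
          nlinarith [sq_nonneg (C₀ * τ)]
      _ ≤ a ^ 2 * (C' ^ 2 * τ ^ 2) := by gcongr
      _ = _ := by ring
  exact htail.trans (by gcongr)

end AnalogSim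

theorem theorem2 :
    -- the absolute constant `c`
    ∃ c : ℝ, 0 < c ∧
    -- the dimension and the implied constants of the hypotheses
    ∀ (d r₀ r₁ s K : ℕ) (ζ κ Γ₀ B δ₀ : ℝ), δ₀ < 1 →
    -- the implied constant of the conclusion, which depends on nothing else
    ∃ C : ℝ, 0 < C ∧
    ∀ (L q : ℕ) [NeZero L]
      -- the geometrically local Hamiltonian `H = ∑ α, h α`
      (h : Torus d L → Operator d L q),
      (∀ α, (h α).IsHermitian) → (∀ α, ‖h α‖ ≤ ζ) →
      (∀ α, ∀ x ∈ opSupport (h α), latticeDist x α ≤ r₀) →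
    -- the local observable
    ∀ O : Operator d L q, O.IsHermitian → (opSupport O).ncard ≤ s →
    -- the local error terms
    ∀ (M : ℕ) (V : Fin M → Operator d L q),
      (M : ℝ) ≤ κ * (L : ℝ) ^ d →
      (∀ i, (V i).IsHermitian) → (∀ i, ‖V i‖ ≤ 1) →
      (∀ i, ∃ β : Torus d L, ∀ x ∈ opSupport (V i), latticeDist x β ≤ r₁) →
      (∀ x : Torus d L, {i | x ∈ opSupport (V i)}.ncard ≤ K) →
    -- the noise
    ∀ (Ω : Type*) [MeasurableSpace Ω] (μ : Measure Ω) [IsProbabilityMeasure μ]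
      (δ : ℝ) (Γ : Fin M → EReal) (χ : Fin M → ℝ → ℝ) (g : Fin M → Ω → ℝ),
      0 < δ → δ ≤ δ₀ → (∀ i, Γ i ≤ (Γ₀ : EReal)) →
      (∀ i, IsDeformedGaussian μ (χ i) δ (Γ i) (g i)) → iIndepFun g μ →
    -- the initial state, the time and the deviation parameter
    ∀ (ρ : Operator d L q), IsState ρ →
    ∀ t : ℝ, 0 ≤ t → t ^ ((d : ℝ) / 2 + 1) * δ ≤ B →
    ∀ a : ℝ, 0 < a →
      1 - 2 * Real.exp (-c * a ^ 2) ≤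
        μ.real {ω |
          ‖(ρ * heisenberg (∑ α, h α + ∑ i, (g i ω : ℂ) • V i) O t).trace
              - (ρ * heisenberg (∑ α, h α) O t).trace‖ ≤
            C * (a * t ^ ((d : ℝ) / 2 + 1) * δ * ‖O‖)
              + C * (a * t * δ * Real.log δ⁻¹ ^ ((d : ℝ) / 2) * ‖O‖)} := by
  refine ⟨1, one_pos, fun d r₀ r₁ s K ζ κ Γ₀ B δ₀ hδ₁ => ?_⟩
  -- no noise strength `δ` is admissible if `δ₀ ≤ 0`
  rcases le_or_gt δ₀ 0 with hδ₀ | hδ₀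
  · refine ⟨1, one_pos, ?_⟩
    intro L q _ h _ _ _ O _ _ M V _ _ _ _ _ Ω _ μ _ δ Γ χ g hδ hδδ₀
    exact absurd (hδ.trans_le hδδ₀) hδ₀.not_gt
  obtain ⟨C₀, hC₀, hcomm⟩ := exists_bound_norm_lie_evolve d r₀ r₁ s K ζ Γ₀
  set e : ℝ := (d : ℝ) / 2 with he
  have he0 : 0 ≤ e := by positivity
  set C₃ : ℝ := 2 ^ e * (1 + 2 * |B|) with hC₃
  set D : ℝ := 2 ^ e * (1 + (Real.log δ₀⁻¹ ^ e)⁻¹) with hD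
  have hlog0 : 0 < Real.log δ₀⁻¹ := Real.log_pos ((one_lt_inv₀ hδ₀).2 hδ₁)
  have hD0 : 0 < D := by
    have := Real.rpow_pos_of_pos hlog0 e
    positivity
  set C' : ℝ := 6 * C₀ + 8 * C₀ * C₃ with hC'
  have hC₃0 : 0 < C₃ := by positivity
  have hC'0 : 0 < C' := by positivity
  refine ⟨C' * D, by positivity, ?_⟩
  intro L q _ h hh hζ hr₀ O hO hOs M V _ hV hV1 hr₁ hK Ω _ μ _ δ Γ χ g hδ hδδ₀ hΓ hg hind ρ hρ t ht
    htB a ha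
  rcases lt_or_ge a (1 / 2) with ha2 | ha2
  · -- for small `a` the asserted probability is not positive
    refine le_trans ?_ measureReal_nonneg
    have h1 := Real.add_one_le_exp (-1 * a ^ 2)
    nlinarith
  set H : Operator d L q := ∑ α, h α with hHdef
  have hH : H.IsHermitian := isSelfAdjoint_sum _ fun α _ => hh α
  have hHy : ∀ y : Fin M → ℝ, (H + ∑ i, (y i : ℂ) • V i).IsHermitian := fun y =>
    IsSelfAdjoint.add hH (isSelfAdjoint_sum _ fun j _ =>
      IsSelfAdjoint.smul (by simp [isSelfAdjoint_iff]) (hV j))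
  set R : ℝ := C' * D * (a * t ^ (e + 1) * δ * ‖O‖)
    + C' * D * (a * t * δ * Real.log δ⁻¹ ^ e * ‖O‖) with hR
  let Φ : (Fin M → ℝ) → ℂ := fun y =>
    (ρ * evolve (H + ∑ i, (y i : ℂ) • V i) O t).trace - (ρ * evolve H O t).trace
  have hΦc : Continuous Φ := (continuous_trace_mul_evolve ρ H O V t).sub continuous_const
  have hT : MeasurableSet {y | ‖Φ y‖ ≤ R} := (isClosed_le hΦc.norm continuous_const).measurableSet
  have htransfer := measureReal_deformedGaussian_eq hg hind hT
  have hgoal : {ω | ‖(ρ * heisenberg (H + ∑ i, (g i ω : ℂ) • V i) O t).trace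
      - (ρ * heisenberg H O t).trace‖ ≤ R} = {ω | (fun i => g i ω) ∈ {y | ‖Φ y‖ ≤ R}} := rfl
  rw [hgoal, htransfer]
  -- the expectation values are real
  have hΦre : ∀ y, ‖Φ y‖ = |(ρ * evolve (H + ∑ i, (y i : ℂ) • V i) O t).trace.re
      - (ρ * evolve H O t).trace.re| := by
    intro y
    have h1 : (Φ y).im = 0 := by
      simp only [Φ, Complex.sub_im]
      rw [im_trace_mul_eq_zero hρ.1.1 (isHermitian_evolve (hHy y) hO t),
        im_trace_mul_eq_zero hρ.1.1 (isHermitian_evolve hH hO t), sub_zero]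
    have h2 : Φ y = ((Φ y).re : ℂ) := Complex.ext rfl (by simpa using h1)
    rw [h2, Complex.norm_real, Real.norm_eq_abs, Complex.sub_re]
  set P := Measure.pi fun _ : Fin M => gaussianReal 0 1 with hP
  have hδ1 : δ ≤ 1 := hδδ₀.trans hδ₁.le
  set τ : ℝ := δ * t * (1 + t) ^ e * ‖O‖ with hτ
  have hτ0 : 0 ≤ τ := by positivity
  have hlogδ : 0 ≤ Real.log δ⁻¹ := Real.log_nonneg ((one_le_inv₀ hδ).2 hδ1)
  have hR0 : 0 ≤ R := by positivity
  have huR : C' * a * τ ≤ R := by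
    have h1 := mul_one_add_rpow_le_log ht he0 hδ hδδ₀ hδ₁
    calc C' * a * τ = C' * a * δ * ‖O‖ * (t * (1 + t) ^ e) := by rw [hτ]; ring
      _ ≤ C' * a * δ * ‖O‖ * (D * (t ^ (e + 1) + t * Real.log δ⁻¹ ^ e)) := by gcongr
      _ = R := by rw [hR]; ring
  rcases hτ0.eq_or_lt with hτz | hτpos
  · -- without evolution, or without observable, there is no deviation at all
    have hΦ0 : ∀ y, Φ y = 0 := by
      have hpow : (1 + t) ^ e ≠ 0 := (Real.rpow_pos_of_pos (by linarith) e).ne'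
      have h1 : t = 0 ∨ O = 0 := by
        rw [hτ] at hτz
        simpa [hδ.ne', hpow] using hτz.symm
      intro y
      rcases h1 with h1 | h1
      · simp only [Φ]
        rw [h1, evolve_zero, evolve_zero, sub_self]
      · simp [Φ, h1, evolve]
    have h1 : {θ : Fin M → ℝ | (fun i => χ i (θ i)) ∈ {y | ‖Φ y‖ ≤ R}} = Set.univ := by
      ext θ
      simp [hΦ0, hR0]
    rw [h1, probReal_univ]
    linarith [Real.exp_pos (-1 * a ^ 2)]
  obtain ⟨w, hw0, hwC, hwsum, hw⟩ := hcomm L q h hh hζ hr₀ O hOs M V hV hV1 hr₁ hK t ht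
  have htail := gaussian_tail_trace_evolve_le_exp hρ hH hV hV1
    (fun i => (hg i).differentiable.continuous) (fun i => (hg i).map_zero)
    (fun i => (hg i).abs_le_mul) (fun i => (hg i).abs_le (hΓ i)) (fun i => (hg i).mean_zero) ht hw
    hw0 hwC hwsum hC₀ hC₃0 he (mul_one_add_rpow_le ht he0 hδ.le hδ1 htB) hτpos ha2
  have hχm : Measurable fun (θ : Fin M → ℝ) i => χ i (θ i) :=
    measurable_pi_iff.2 fun i =>
      (hg i).differentiable.continuous.measurable.comp (measurable_pi_apply i)
  have hcompl := probReal_compl_eq_one_sub (μ := P) (hχm hT)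
  have hsub : (P.real ((fun (θ : Fin M → ℝ) i => χ i (θ i)) ⁻¹' {y | ‖Φ y‖ ≤ R})ᶜ)
      ≤ 2 * Real.exp (-1 * a ^ 2) := by
    rw [neg_one_mul]
    refine (measureReal_mono (fun θ hθ => ?_)).trans htail
    have h1 : R < ‖Φ fun i => χ i (θ i)‖ := not_le.1 hθ
    rw [hΦre] at h1
    exact huR.trans_lt h1
  have hset : {θ : Fin M → ℝ | (fun i => χ i (θ i)) ∈ {y | ‖Φ y‖ ≤ R}}
      = (fun (θ : Fin M → ℝ) i => χ i (θ i)) ⁻¹' {y | ‖Φ y‖ ≤ R} := rfl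
  rw [hset]
  linarith
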